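/- Let $G$ be a finite simple maximal planar graph (planar: $G$ can be embedded in the plane so that edges meet only at common end points; maximal: no edge can be added without violating planarity) in which every vertex belongs to at least one 3-clique, and let $K$ be the set of 3-cliques (sets of three mutually adjacent vertices) of $G$. The removal of $k\in K$ divides the rest of $G$ into two parts with every path from one part to the other meeting $k$; $k$ is separating if both parts can be taken non-empty, and then they are taken so. Call the part with fewer vertices the interior $G^{k}_{in}$ and the other part the exterior of $k$, with an arbitrary choice if both have the same number of vertices (so $G^k_{in}=\emptyset$ if $k$ is not separating). Unions of subgraphs are the subgraphs of $G$ induced by the union of the vertex sets. Put $k\preceq_K k'$ if $k\cup G^{k}_{in}\subseteq k'\cup G^{k'}_{in}$, and let $K'=K\cup\{k_{imag}\}$, where $k_{imag}$ is an additional (imaginary) element with interior $G$, with $\preceq_{K'}$ defined by the same formula. In a partially ordered set, $x$ covers $y\neq x$ if $y\preceq x$ and there is no further element $z$ with $y\preceq z\preceq x$. Let $H$ be the directed graph on $K$ with an edge from $k$ to $k'$ if $k'$ covers $k$ in $(K,\preceq_K)$. For every $k\in K$ with at least one incoming edge in $H$, the bubble with root $k$ is the graph union of $k$ with all its incoming neighbours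 in $H$; the bubble $b_\rho$ with root $k_{imag}$ is the graph union of all maximal elements of $(K,\preceq_K)$. Let $B'$ be the set of all these bubbles, ordered by $b\preceq_{B'}b'$ if the root of $b$ is $\preceq_{K'}$ the root of $b'$, and let $H_b$ be the directed graph on $B'$ with an edge from $b$ to $b'$ if $b$ covers $b'$ in $(B',\preceq_{B'})$. Then, for every choice of interiors as above and any two distinct bubbles $b_i,b_j\in B'$: $b_i$ is an incoming or outgoing neighbour of $b_j$ in $H_b$ if and only if $b_i$ and $b_j$ have a common 3-clique; and in this case they have exactly one common 3-clique. -/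

import Mathlib

/-! ### Planar and maximal planar graphs -/

/-- The Euclidean plane. -/
abbrev Plane : Type := EuclideanSpace ℝ (Fin 2)

/-- An embedding of a simple graph in the plane: vertices are distinct points, every edge is a
simple arc (an injective continuous image of `[0,1]`) joining the points of its two end vertices,
and arcs meet vertices, and each other, only at common end points. -/
structure PlaneEmbedding {V : Type*} (G : SimpleGraph V) where
  pos : V → Plane
  arc : G.edgeSet → unitInterval → Plane
  pos_injective : Function.Injective pos
  arc_continuous : ∀ e, Continuous (arc e)
  arc_injective : ∀ e, Function.Injective (arc e)
  arc_ends : ∀ e, s(arc e 0, arc e 1) = Sym2.map pos (e : Sym2 V)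
  arc_vertex : ∀ e t v, arc e t = pos v → v ∈ (e : Sym2 V)
  arc_inter : ∀ e f s t, e ≠ f → arc e s = arc f t →
    ∃ v, v ∈ (e : Sym2 V) ∧ v ∈ (f : Sym2 V) ∧ arc e s = pos v

/-- A graph is planar if it has an embedding in the plane. -/
def IsPlanar {V : Type*} (G : SimpleGraph V) : Prop :=
  Nonempty (PlaneEmbedding G)

/-- A graph is maximal planar if it is planar and no edges can be added (on the same vertex set)
without violating planarity. -/
def IsMaximalPlanar {V : Type*} (G : SimpleGraph V) : Prop :=
  Maximal (IsPlanar (V := V)) G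

/-! ### 3-cliques, their interiors and exteriors -/

/-- The set `K` of 3-cliques of `G`, each given by its three vertices. -/
abbrev ThreeClique {V : Type*} (G : SimpleGraph V) : Type _ :=
  {k : Finset V // G.IsNClique 3 k}

/-- Removing the vertex set `k` divides `G` into the parts `S` and `S'` (possibly empty): they
partition the remaining vertices, and every path from `S` to `S'` meets `k`. -/
def Divides {V : Type*} [Fintype V] [DecidableEq V] (G : SimpleGraph V)
    (k S S' : Finset V) : Prop :=
  Disjoint S S' ∧ S ∪ S' = kᶜ ∧
    ∀ i ∈ S, ∀ j ∈ S', ∀ p : G.Path i j, ∃ v ∈ k, v ∈ (p : G.Walk i j).support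

/-- `k` is separating if its removal divides `G` into two non-empty parts. -/
def IsSeparating {V : Type*} [Fintype V] [DecidableEq V] (G : SimpleGraph V)
    (k : Finset V) : Prop :=
  ∃ S S' : Finset V, S.Nonempty ∧ S'.Nonempty ∧ Divides G k S S'

/-- A choice of interior and exterior (given by their vertex sets) for all 3-cliques of `G`. They
are the two parts into which the removal of the 3-clique divides `G`, both non-empty if the 3-clique
is separating (otherwise one of them is necessarily empty). The interior is the part of smaller
order; if the two orders are equal, either choice is allowed. -/
structure CliqueOrientation {V : Type*} [Fintype V] [DecidableEq V] (G : SimpleGraph V) where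
  interior : ThreeClique G → Finset V
  exterior : ThreeClique G → Finset V
  divides : ∀ k, Divides G k.1 (interior k) (exterior k)
  nonempty_of_separating : ∀ k, IsSeparating G k.1 → (interior k).Nonempty ∧ (exterior k).Nonempty
  card_le : ∀ k, (interior k).card ≤ (exterior k).card

/-- `x` covers `y` with respect to the relation `le`: `y` lies below `x`, `y ≠ x`, and there is no
other element between them. -/
def Covers {α : Type*} (le : α → α → Prop) (x y : α) : Prop :=
  le y x ∧ y ≠ x ∧ ∀ z, le y z → le z x → z = y ∨ z = x

namespace CliqueOrientation

variable {V : Type*} [Fintype V] [DecidableEq V] {G : SimpleGraph V} (o : CliqueOrientation G)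

/-! ### The hierarchy of 3-cliques -/

/-- The vertex set of `k ∪ G_in^k`. -/
def closedInterior (k : ThreeClique G) : Finset V :=
  k.1 ∪ o.interior k

/-- `k ⪯_K k'` if `k ∪ G_in^k` is contained in `k' ∪ G_in^{k'}`. (These are induced subgraphs of
`G`, so that containment is containment of the vertex sets.) -/
def cliqueLE (k k' : ThreeClique G) : Prop :=
  o.closedInterior k ⊆ o.closedInterior k'

/-- The hierarchical graph `H` of 3-cliques: an edge from `k` to `k'` if `k'` covers `k`. -/
def cliqueGraph : Digraph (ThreeClique G) where
  Adj k k' := Covers o.cliqueLE k' k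

/-- `k` is a maximal element of `(K, ⪯_K)`. -/
def IsMaximalClique (k : ThreeClique G) : Prop :=
  ∀ k', o.cliqueLE k k' → k' = k

/-- The closed interior on `K' = K ∪ {k_imag}`, where `none` stands for the imaginary 3-clique
`k_imag`, whose interior is all of `G`. -/
def closedInterior' : Option (ThreeClique G) → Finset V
  | some k => o.closedInterior k
  | none => Finset.univ

/-- The relation `⪯_{K'}` on `K' = K ∪ {k_imag}`. -/
def cliqueLE' (x y : Option (ThreeClique G)) : Prop :=
  o.closedInterior' x ⊆ o.closedInterior' y

/-! ### Bubbles and the bubble hierarchical tree -/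

/-- The graph union of a family of 3-cliques: the subgraph of `G` induced by all their vertices. -/
def graphUnion (G : SimpleGraph V) (F : Set (ThreeClique G)) : G.Subgraph :=
  (⊤ : G.Subgraph).induce {v | ∃ k ∈ F, v ∈ k.1}

/-- The members of `K'` that are roots of bubbles: the 3-cliques with an incoming edge in `H`, and
the imaginary 3-clique. -/
def IsRoot : Option (ThreeClique G) → Prop
  | some k => ∃ k', o.cliqueGraph.Adj k' k
  | none => True

/-- The bubble with a given root: the graph union of the 3-clique `k` with all its incoming
neighbours in `H`; for the imaginary 3-clique, the graph union `b_ρ` of all maximal 3-cliques. -/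
def bubble : Option (ThreeClique G) → G.Subgraph
  | some k => graphUnion G {k' | k' = k ∨ o.cliqueGraph.Adj k' k}
  | none => graphUnion G {k | o.IsMaximalClique k}

/-- The set `B'` of bubbles of `G`. -/
def bubbles : Set G.Subgraph :=
  {b | ∃ x, o.IsRoot x ∧ o.bubble x = b}

/-- `b ⪯_{B'} b'` if `x ⪯_{K'} x'` for the roots `x` of `b` and `x'` of `b'`. -/
def bubbleLE (b b' : o.bubbles) : Prop :=
  ∃ x x', o.IsRoot x ∧ o.bubble x = b.1 ∧ o.IsRoot x' ∧ o.bubble x' = b'.1 ∧ o.cliqueLE' x x'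

/-- The bubble hierarchical tree `H_b`: the vertices are the bubbles, and there is an edge from `b`
to `b'` if `b` covers `b'` in `(B', ⪯_{B'})`. -/
def bubbleTree : Digraph o.bubbles where
  Adj b b' := Covers o.bubbleLE b b'

/-- `b` and `b'` are neighbours in `H_b`: one is an incoming or outgoing neighbour at the other. -/
def BubbleNeighbors (b b' : o.bubbles) : Prop :=
  o.bubbleTree.Adj b b' ∨ o.bubbleTree.Adj b' b

/-- The 3-clique `k` of `G` is a 3-clique of the subgraph `b`. -/
def IsCliqueOf (k : ThreeClique G) (b : G.Subgraph) : Prop :=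
  b.spanningCoe.IsNClique 3 k.1

end CliqueOrientation

/-! ### Arcs -/

/-! Planarity enters only through `IsMaximalPlanar.exists_adj_of_isNClique`: if `C` is a non-empty
union of components of `G - k`, then every `z ∈ k` has a neighbour in `C`. Suppose `z` has none. If
another vertex `u` of `k` has a neighbour in `C`, let `w` be the third vertex of `k` and cut the
cyclic order of the edges at `u` at `w`. The remaining neighbours lie in `C` or outside of it, and
both kinds occur (`z` is outside), so somewhere they are consecutive, say `a ∈ C` and `y ∉ C`. An
edge `ay` can be drawn along `a-u-y`, so by maximality it is present; since `C` only has neighbours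
in `k`, this forces `y = z`, a contradiction. If no vertex of `k` has a neighbour in `C`, an edge
can be drawn between `C` and the rest.

The drawn edge comes from surgery on drawings: the inside of a disc is replaced by a star
(`Drawing.exists_star`), points of edges become vertices, these are joined by a segment
(`exists_chord` supplies one missing the star), and the new vertices are contracted again
(`Drawing.nonempty_contract`).

The rest is combinatorial. A 3-clique inside the closed interior of `k` has its whole closed
interior there (`cliqueLE_iff`), because the opposite nesting contradicts the sizes of interiors and
exteriors; ties do no harm since that comparison is strict. Closed interiors of incomparable
3-cliques share only vertices of both 3-cliques, so a 3-clique has only one cover in `K'`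
(`IsChild.unique`): the order is a tree. A bubble contains no 3-cliques besides its root and the
elements covered by it (`isCliqueOf_bubble_iff`). Hence two bubbles share a 3-clique exactly if one
root covers the other, and then they share just the lower root. -/

/-- `S` is a simple arc with end points `x` and `y`. -/
def IsArc (x y : Plane) (S : Set Plane) : Prop :=
  ∃ (a b : ℝ) (f : ℝ → Plane), a < b ∧ ContinuousOn f (Set.Icc a b) ∧ Set.InjOn f (Set.Icc a b) ∧
    f a = x ∧ f b = y ∧ f '' Set.Icc a b = S

namespace IsArc

variable {x y z : Plane} {S S' T : Set Plane}

lemma left_mem (h : IsArc x y S) : x ∈ S := by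
  obtain ⟨a, b, f, hab, -, -, rfl, -, rfl⟩ := h
  exact ⟨a, Set.left_mem_Icc.2 hab.le, rfl⟩

lemma right_mem (h : IsArc x y S) : y ∈ S := by
  obtain ⟨a, b, f, hab, -, -, -, rfl, rfl⟩ := h
  exact ⟨b, Set.right_mem_Icc.2 hab.le, rfl⟩

lemma isCompact (h : IsArc x y S) : IsCompact S := by
  obtain ⟨a, b, f, hab, hc, -, -, -, rfl⟩ := h
  exact isCompact_Icc.image_of_continuousOn hc

lemma ne (h : IsArc x y S) : x ≠ y := by
  obtain ⟨a, b, f, hab, -, hi, rfl, rfl, -⟩ := h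
  exact fun h => hab.ne (hi (Set.left_mem_Icc.2 hab.le) (Set.right_mem_Icc.2 hab.le) h)

lemma symm (h : IsArc x y S) : IsArc y x S := by
  obtain ⟨a, b, f, hab, hc, hi, rfl, rfl, rfl⟩ := h
  have hm : Set.MapsTo (fun t : ℝ => -t) (Set.Icc (-b) (-a)) (Set.Icc a b) := fun t ht =>
    ⟨by linarith [ht.2], by linarith [ht.1]⟩
  refine ⟨-b, -a, fun t => f (-t), by linarith, hc.comp continuous_neg.continuousOn hm,
    hi.comp neg_injective.injOn hm, by simp, by simp, ?_⟩
  have : (fun t => f (-t)) = f ∘ (fun t : ℝ => -t) := rfl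
  rw [this, Set.image_comp]
  simp

/-- The affine reparametrization of an arc. -/
lemma exists_param (h : IsArc x y S) (c d : ℝ) (hcd : c < d) :
    ∃ f : ℝ → Plane, ContinuousOn f (Set.Icc c d) ∧ Set.InjOn f (Set.Icc c d) ∧
      f c = x ∧ f d = y ∧ f '' Set.Icc c d = S := by
  obtain ⟨a, b, f, hab, hc, hi, rfl, rfl, rfl⟩ := h
  have h1 : 0 < d - c := by linarith
  have h2 : 0 < b - a := by linarith
  set k := (b - a) / (d - c) with hk
  have hkpos : 0 < k := div_pos h2 h1
  have hkd : k * (d - c) = b - a := by rw [hk]; field_simp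
  set g : ℝ → ℝ := fun t => a + k * (t - c) with hg
  have hgi : Function.Injective g := by
    intro s t hst
    simp only [hg] at hst
    have : k * (s - t) = 0 := by linarith
    rcases mul_eq_zero.1 this with h | h <;> linarith
  have him : g '' Set.Icc c d = Set.Icc a b := by
    ext t
    constructor
    · rintro ⟨s, ⟨hs1, hs2⟩, rfl⟩
      simp only [hg]
      constructor
      · nlinarith
      · nlinarith
    · rintro ⟨ht1, ht2⟩
      refine ⟨c + (t - a) / k, ⟨?_, ?_⟩, ?_⟩
      · have := div_nonneg (sub_nonneg.2 ht1) hkpos.le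
        linarith
      · have : (t - a) / k ≤ d - c := by
          rw [div_le_iff₀ hkpos]; linarith
        linarith
      · simp only [hg]; field_simp; ring
  have hm : Set.MapsTo g (Set.Icc c d) (Set.Icc a b) := fun t ht => him ▸ ⟨t, ht, rfl⟩
  have hgc : Continuous g := by fun_prop
  refine ⟨f ∘ g, hc.comp hgc.continuousOn hm, hi.comp hgi.injOn hm, ?_, ?_, ?_⟩
  · simp [hg]
  · simp only [Function.comp, hg, hkd]; congr 1; ring
  · rw [Set.image_comp, him]

lemma trans (h : IsArc x y S) (h' : IsArc y z S') (hi : S ∩ S' ⊆ {y}) : IsArc x z (S ∪ S') := by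
  obtain ⟨f, fc, fi, f0, f1, rfl⟩ := h.exists_param 0 1 one_pos
  obtain ⟨g, gc, gi, g1, g2, rfl⟩ := h'.exists_param 1 2 one_lt_two
  set k : ℝ → Plane := fun t => if t ≤ 1 then f t else g t with hk
  have kf : Set.EqOn k f (Set.Icc 0 1) := fun t ht => if_pos ht.2
  have kg : Set.EqOn k g (Set.Icc 1 2) := by
    intro t ht
    rcases eq_or_lt_of_le ht.1 with rfl | h
    · simp [hk, f1, g1]
    · exact if_neg (not_le.2 h)
  have hU : Set.Icc (0 : ℝ) 1 ∪ Set.Icc 1 2 = Set.Icc 0 2 :=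
    Set.Icc_union_Icc_eq_Icc zero_le_one one_le_two
  have key : ∀ s ∈ Set.Icc (0 : ℝ) 1, ∀ t ∈ Set.Icc (1 : ℝ) 2, k s = k t → s = t := by
    intro s hs t ht hst
    rw [kf hs, kg ht] at hst
    have hy : f s = y := hi ⟨⟨s, hs, rfl⟩, ⟨t, ht, hst.symm⟩⟩
    have hs1 : s = 1 := fi hs (by simp) (hy.trans f1.symm)
    have ht1 : t = 1 := gi ht (by norm_num) (hst.symm.trans (hy.trans g1.symm))
    rw [hs1, ht1]
  refine ⟨0, 2, k, two_pos, ?_, ?_, ?_, ?_, ?_⟩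
  · rw [← hU]
    exact (fc.congr kf).union_of_isClosed (gc.congr kg) isClosed_Icc isClosed_Icc
  · rw [← hU]
    rintro s (hs | hs) t (ht | ht) hst
    · rw [kf hs, kf ht] at hst; exact fi hs ht hst
    · exact key s hs t ht hst
    · exact (key t ht s hs hst.symm).symm
    · rw [kg hs, kg ht] at hst; exact gi hs ht hst
  · rw [kf (by simp), f0]
  · rw [kg (by norm_num), g2]
  · rw [← hU, Set.image_union, kf.image_eq, kg.image_eq]

lemma segment (h : x ≠ y) : IsArc x y (segment ℝ x y) := by
  refine ⟨0, 1, AffineMap.lineMap x y, one_pos, ?_, ?_, by simp, by simp, ?_⟩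
  · exact AffineMap.lineMap_continuous.continuousOn
  · exact (AffineMap.lineMap_injective ℝ h).injOn
  · rw [segment_eq_image_lineMap]

lemma sub_param {a b c d : ℝ} {f : ℝ → Plane} (hc : ContinuousOn f (Set.Icc a b))
    (hi : Set.InjOn f (Set.Icc a b)) (hac : a ≤ c) (hcd : c < d) (hdb : d ≤ b) :
    IsArc (f c) (f d) (f '' Set.Icc c d) :=
  have hs : Set.Icc c d ⊆ Set.Icc a b := Set.Icc_subset_Icc hac hdb
  ⟨c, d, f, hcd, hc.mono hs, hi.mono hs, rfl, rfl, rfl⟩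

lemma split (h : IsArc x y S) {p : Plane} (hp : p ∈ S) (hx : p ≠ x) (hy : p ≠ y) :
    ∃ S₁ S₂, IsArc x p S₁ ∧ IsArc p y S₂ ∧ S₁ ∩ S₂ ⊆ {p} ∧ S₁ ∪ S₂ = S := by
  obtain ⟨a, b, f, hab, hc, hi, rfl, rfl, rfl⟩ := h
  obtain ⟨c, ⟨hac, hcb⟩, rfl⟩ := hp
  have hac' : a < c := lt_of_le_of_ne hac (fun h => hx (by rw [h]))
  have hcb' : c < b := lt_of_le_of_ne hcb (fun h => hy (by rw [h]))
  refine ⟨_, _, sub_param hc hi le_rfl hac' hcb, sub_param hc hi hac hcb' le_rfl, ?_, ?_⟩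
  · rintro _ ⟨⟨s, hs, rfl⟩, ⟨t, ht, hst⟩⟩
    have : t = s := hi ⟨hac.trans ht.1, ht.2⟩ ⟨hs.1, hs.2.trans hcb⟩ hst
    subst this
    rw [le_antisymm hs.2 ht.1]; rfl
  · rw [← Set.image_union, Set.Icc_union_Icc_eq_Icc hac hcb]

/-- The part of an arc after its last point in a closed set. -/
lemma last_exit (h : IsArc x y S) (hT : IsClosed T) (hx : x ∈ T) (hy : y ∉ T) :
    ∃ p S', IsArc p y S' ∧ S' ⊆ S ∧ p ∈ T ∧ p ∉ interior T ∧ S' ∩ T ⊆ {p} := by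
  obtain ⟨a, b, f, hab, hc, hi, rfl, rfl, rfl⟩ := h
  have hK : IsCompact (Set.Icc a b ∩ f ⁻¹' T) :=
    isCompact_Icc.of_isClosed_subset (hc.preimage_isClosed_of_isClosed isClosed_Icc hT)
      Set.inter_subset_left
  obtain ⟨c, ⟨⟨hac, hcb⟩, hcT⟩, hmax⟩ :=
    hK.exists_isGreatest ⟨a, Set.left_mem_Icc.2 hab.le, hx⟩
  have hcb' : c < b := lt_of_le_of_ne hcb (fun h => hy (h ▸ hcT))
  have hlast : ∀ t ∈ Set.Icc c b, f t ∈ T → t = c := fun t ht htT =>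
    le_antisymm (hmax ⟨⟨hac.trans ht.1, ht.2⟩, htT⟩) ht.1
  refine ⟨f c, _, sub_param hc hi hac hcb' le_rfl,
    Set.image_mono (Set.Icc_subset_Icc_left hac), hcT, fun hint => ?_, ?_⟩
  -- If the last point were interior to `T`, slightly later parameters would still be mapped into
  -- `T`.
  · have hcont : ContinuousWithinAt f (Set.Ioc c b) c :=
      (hc c ⟨hac, hcb⟩).mono fun t ht => ⟨hac.trans ht.1.le, ht.2⟩
    have h1 : ∀ᶠ t in nhdsWithin c (Set.Ioc c b), f t ∈ T :=
      hcont (mem_interior_iff_mem_nhds.1 hint)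
    have : (nhdsWithin c (Set.Ioc c b)).NeBot := by
      rw [nhdsWithin_Ioc_eq_nhdsGT hcb']; infer_instance
    obtain ⟨t, htT, ht⟩ := (h1.and self_mem_nhdsWithin).exists
    exact ht.1.ne' (hlast t ⟨ht.1.le, ht.2⟩ htT)
  · rintro _ ⟨⟨t, ht, rfl⟩, htT⟩
    rw [hlast t ht htT]; rfl

/-- An arc approaches its end through connected subsets that avoid this end. -/
lemma approach (h : IsArc x y S) {U : Set Plane} (hU : U ∈ nhds y) :
    ∃ p K, IsPreconnected K ∧ x ∈ K ∧ p ∈ K ∧ y ∉ K ∧ K ⊆ S ∧ p ∈ U := by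
  obtain ⟨a, b, f, hab, hc, hi, rfl, rfl, rfl⟩ := h
  have hcont : ContinuousWithinAt f (Set.Ico a b) b :=
    (hc b ⟨hab.le, le_rfl⟩).mono Set.Ico_subset_Icc_self
  have h1 : ∀ᶠ t in nhdsWithin b (Set.Ico a b), f t ∈ U := hcont hU
  have : (nhdsWithin b (Set.Ico a b)).NeBot := by
    rw [nhdsWithin_Ico_eq_nhdsLT hab]; infer_instance
  obtain ⟨t, htU, ht⟩ := (h1.and self_mem_nhdsWithin).exists
  have hs : Set.Icc a t ⊆ Set.Icc a b := Set.Icc_subset_Icc_right ht.2.le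
  refine ⟨f t, f '' Set.Icc a t, isPreconnected_Icc.image f (hc.mono hs),
    ⟨a, ⟨le_rfl, ht.1⟩, rfl⟩, ⟨t, ⟨ht.1, le_rfl⟩, rfl⟩, ?_, Set.image_mono hs, htU⟩
  rintro ⟨s, hs', h⟩
  have := hi (hs hs') ⟨hab.le, le_rfl⟩ h
  exact absurd hs'.2 (not_le.2 (this ▸ ht.2))

lemma exists_unitInterval (h : IsArc x y S) : ∃ f : unitInterval → Plane,
    Continuous f ∧ Function.Injective f ∧ f 0 = x ∧ f 1 = y ∧ Set.range f = S := by
  obtain ⟨f, fc, fi, f0, f1, hS⟩ := h.exists_param 0 1 one_pos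
  refine ⟨fun t => f t, continuousOn_iff_continuous_domRestrict.1 fc,
    fun s t hst => Subtype.ext (fi s.2 t.2 hst), f0, f1, ?_⟩
  rw [← hS]
  ext p
  simp

lemma of_unitInterval {f : unitInterval → Plane} (hc : Continuous f) (hi : Function.Injective f) :
    IsArc (f 0) (f 1) (Set.range f) := by
  have hp : ∀ t : unitInterval, Set.projIcc (0 : ℝ) 1 zero_le_one t = t := fun t =>
    Set.projIcc_val zero_le_one t
  refine ⟨0, 1, f ∘ Set.projIcc 0 1 zero_le_one, one_pos,
    (hc.comp continuous_projIcc).continuousOn, ?_, by simp, by simp, ?_⟩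
  · intro s hs t ht hst
    have := hi hst
    rw [Set.projIcc_of_mem _ hs, Set.projIcc_of_mem _ ht] at this
    exact congrArg Subtype.val this
  · ext p
    constructor
    · rintro ⟨t, ht, rfl⟩; exact ⟨_, rfl⟩
    · rintro ⟨t, rfl⟩; exact ⟨t, t.2, by simp⟩

end IsArc

/-- Segments from an interior point of a convex set to distinct points outside of the interior meet
only at their common end point. -/
lemma segment_inter_of_notMem_interior {T : Set Plane} (hT : Convex ℝ T) {m x y z : Plane}
    (hm : m ∈ interior T) (hx : x ∈ T) (hy : y ∈ T) (hx' : x ∉ interior T) (hy' : y ∉ interior T)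
    (hne : x ≠ y) (hzx : z ∈ segment ℝ m x) (hzy : z ∈ segment ℝ m y) : z = m := by
  rw [segment_eq_image_lineMap] at hzx hzy
  obtain ⟨s, hs, rfl⟩ := hzx
  obtain ⟨t, ht, hst⟩ := hzy
  simp only [AffineMap.lineMap_apply, vsub_eq_sub, vadd_eq_add] at *
  wlog hle : s ≤ t generalizing s t x y
  · rw [← hst]
    exact this hy hx hy' hx' hne.symm t ht s hs hst.symm (le_of_not_ge hle)
  rcases eq_or_lt_of_le hs.1 with h0 | h0
  · rw [← h0]; simp
  exfalso
  have ht0 : 0 < t := h0.trans_le hle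
  -- A common point other than `m` puts `x` and `y` on one ray from `m`, with `y` no farther out
  -- than `x`. If it were strictly nearer, convexity would place it in the interior.
  have hyx : y - m = (s / t) • (x - m) := by
    have h := add_right_cancel hst
    rw [div_eq_inv_mul, mul_smul, ← h, smul_smul, inv_mul_cancel₀ ht0.ne', one_smul]
  have hy2 : y = (1 - s / t) • m + (s / t) • x := by
    rw [← sub_add_cancel y m, hyx, smul_sub, sub_smul, one_smul]; abel
  rcases eq_or_lt_of_le hle with rfl | hlt
  · rw [div_self ht0.ne', one_smul] at hyx
    exact hne (sub_left_injective hyx).symm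
  · apply hy'
    rw [hy2]
    have h1 : s / t < 1 := (div_lt_one ht0).2 hlt
    exact hT.combo_interior_self_mem_interior hm hx (by linarith) (div_pos h0 ht0).le (by ring)

/-! ### Drawings -/

/-- A plane drawing of a graph, with edges drawn as sets of points. -/
structure Drawing {V : Type*} (G : SimpleGraph V) where
  pos : V → Plane
  arc : V → V → Set Plane
  pos_injective : Function.Injective pos
  arc_symm : ∀ u v, arc u v = arc v u
  isArc : ∀ {u v}, G.Adj u v → IsArc (pos u) (pos v) (arc u v)
  mem_arc : ∀ {u v w}, G.Adj u v → pos w ∈ arc u v → w = u ∨ w = v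
  inter : ∀ {u v u' v' x}, G.Adj u v → G.Adj u' v' → x ∈ arc u v → x ∈ arc u' v' →
    s(u, v) ≠ s(u', v') → ∃ z, (z = u ∨ z = v) ∧ (z = u' ∨ z = v') ∧ x = pos z

lemma PlaneEmbedding.nonempty_drawing {V : Type*} {G : SimpleGraph V} (E : PlaneEmbedding G) :
    Nonempty (Drawing G) := by
  classical
  refine ⟨⟨E.pos, fun u v => if h : G.Adj u v then Set.range (E.arc ⟨s(u, v), h⟩) else ∅,
    E.pos_injective, ?_, ?_, ?_, ?_⟩⟩
  · intro u v
    by_cases h : G.Adj u v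
    · have h' := h.symm
      simp only [h, h', dif_pos]
      have : (⟨s(u, v), h⟩ : G.edgeSet) = ⟨s(v, u), h'⟩ := Subtype.ext Sym2.eq_swap
      rw [this]
    · have h' : ¬ G.Adj v u := fun h' => h h'.symm
      simp only [h, h', dif_neg, not_false_eq_true]
  · intro u v h
    simp only [h, dif_pos]
    have hA := IsArc.of_unitInterval (E.arc_continuous ⟨s(u, v), h⟩) (E.arc_injective ⟨s(u, v), h⟩)
    have he := E.arc_ends ⟨s(u, v), h⟩
    rw [Sym2.map_mk, Sym2.eq_iff] at he
    rcases he with ⟨h0, h1⟩ | ⟨h0, h1⟩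
    · rwa [h0, h1] at hA
    · rw [h0, h1] at hA; exact hA.symm
  · intro u v w h hw
    simp only [h, dif_pos] at hw
    obtain ⟨t, ht⟩ := hw
    simpa using E.arc_vertex _ t w ht
  · intro u v u' v' x h h' hx hx' hne
    simp only [h, h', dif_pos] at hx hx'
    obtain ⟨s, rfl⟩ := hx
    obtain ⟨t, ht⟩ := hx'
    obtain ⟨z, hz, hz', hp⟩ := E.arc_inter ⟨s(u, v), h⟩ ⟨s(u', v'), h'⟩ s t
      (fun h => hne (congrArg Subtype.val h)) ht.symm
    exact ⟨z, by simpa using hz, by simpa using hz', hp⟩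

namespace Drawing

/-- With edges as mere point sets, surgery needs no bookkeeping of parameters; parametrizations are
chosen only here, after the surgery. -/
lemma isPlanar {V : Type*} {G : SimpleGraph V} (D : Drawing G) : IsPlanar G := by
  have key : ∀ e : G.edgeSet, ∃ f : unitInterval → Plane, ∃ u v, (e : Sym2 V) = s(u, v) ∧
      G.Adj u v ∧ Continuous f ∧ Function.Injective f ∧ f 0 = D.pos u ∧ f 1 = D.pos v ∧
      Set.range f = D.arc u v := by
    rintro ⟨e, he⟩
    induction e using Sym2.ind with
    | _ u v =>
      obtain ⟨f, h⟩ := (D.isArc he).exists_unitInterval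
      exact ⟨f, u, v, rfl, he, h⟩
  choose f u v he hadj hc hi h0 h1 hr using key
  refine ⟨⟨D.pos, f, D.pos_injective, hc, hi, ?_, ?_, ?_⟩⟩
  · intro e
    rw [he, Sym2.map_mk, h0, h1]
  · intro e t w hw
    rw [he, Sym2.mem_iff]
    exact D.mem_arc (hadj e) (hr e ▸ ⟨t, hw⟩)
  · intro e e' s t hne hst
    obtain ⟨z, hz, hz', hx⟩ := D.inter (x := f e s) (hadj e) (hadj e') (hr e ▸ ⟨s, rfl⟩)
      (hr e' ▸ ⟨t, hst.symm⟩) (by rw [← he, ← he]; exact fun h => hne (Subtype.ext h))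
    exact ⟨z, by rw [he, Sym2.mem_iff]; exact hz, by rw [he, Sym2.mem_iff]; exact hz', hx⟩

/-! ### Redrawing inside a disc: stars, moving a vertex, contraction. -/

variable {V V' : Type*} {G : SimpleGraph V}

/-- Replace everything inside a convex set `T` by a star with centre `m`. The vertices of the new
graph `G'` outside of `T` are vertices of the drawn graph `G`, and every edge at the centre `c`
continues an edge of `G` that leaves `T` at the point `x v`. -/
theorem exists_star (D : Drawing G) {G' : SimpleGraph V'} {φ : V' → V}
    (hφ : Function.Injective φ) (c : V') {T : Set Plane} (hconv : Convex ℝ T) {m : Plane}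
    (hm : m ∈ interior T) (hout : ∀ v, v ≠ c → D.pos (φ v) ∉ T)
    (hadj : ∀ v w, v ≠ c → w ≠ c → G'.Adj v w →
      G.Adj (φ v) (φ w) ∧ Disjoint (D.arc (φ v) (φ w)) T)
    (α : V' → V) (hα : ∀ v, G'.Adj c v → G.Adj (α v) (φ v) ∧ D.pos (α v) ∈ interior T)
    (x : V' → Plane) (S : V' → Set Plane)
    (hS : ∀ v, G'.Adj c v → IsArc (x v) (D.pos (φ v)) (S v) ∧ S v ⊆ D.arc (α v) (φ v) ∧
      x v ∈ T ∧ x v ∉ interior T ∧ S v ∩ T ⊆ {x v}) :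
    ∃ D' : Drawing G', D'.pos c = m ∧ (∀ v, v ≠ c → D'.pos v = D.pos (φ v)) ∧
      (∀ v w, v ≠ c → w ≠ c → D'.arc v w = D.arc (φ v) (φ w)) ∧
      ∀ v, D'.arc c v = segment ℝ m (x v) ∪ S v := by
  classical
  have hint : interior T ⊆ T := interior_subset
  -- The new edge from `c` to `v`: a straight ray up to the exit point `x v`, then the retained tail
  -- of the old edge.
  set A : V' → Set Plane := fun v => segment ℝ m (x v) ∪ S v with hA
  have hseg : ∀ v, G'.Adj c v → segment ℝ m (x v) ⊆ T := fun v hv =>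
    hconv.segment_subset (hint hm) (hS v hv).2.2.1
  have hαout : ∀ v w, G'.Adj c v → w ≠ c → α v ≠ φ w := fun v w hv hw h =>
    hout w hw (h ▸ hint (hα v hv).2)
  have arcA : ∀ v, G'.Adj c v → IsArc m (D.pos (φ v)) (A v) := by
    intro v hv
    obtain ⟨h1, -, h3, h4, h5⟩ := hS v hv
    refine (IsArc.segment (fun h : m = x v => h4 (h ▸ hm))).trans h1 ?_
    rintro z ⟨hz, hz'⟩
    exact h5 ⟨hz', hseg v hv hz⟩
  have memA : ∀ v w, G'.Adj c v → w ≠ c → D.pos (φ w) ∈ A v → w = v := by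
    intro v w hv hw h
    rcases h with h | h
    · exact absurd (hseg v hv h) (hout w hw)
    · rcases D.mem_arc (hα v hv).1 ((hS v hv).2.1 h) with h | h
      · exact absurd h.symm (hαout v w hv hw)
      · exact hφ h
  have interA : ∀ v v' w' z, G'.Adj c v → v' ≠ c → w' ≠ c → G'.Adj v' w' → z ∈ A v →
      z ∈ D.arc (φ v') (φ w') → (v = v' ∨ v = w') ∧ z = D.pos (φ v) := by
    intro v v' w' z hv hv' hw' h hz hz'
    obtain ⟨hadj', hdis⟩ := hadj v' w' hv' hw' h
    have hzT : z ∉ T := Set.disjoint_left.1 hdis hz'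
    have hzS : z ∈ S v := hz.resolve_left (fun h => hzT (hseg v hv h))
    have hne : s(α v, φ v) ≠ s(φ v', φ w') := by
      intro he
      have : α v ∈ s(φ v', φ w') := he ▸ Sym2.mem_mk_left _ _
      rcases Sym2.mem_iff.1 this with h | h
      · exact hαout v v' hv hv' h
      · exact hαout v w' hv hw' h
    obtain ⟨y, hy, hy', hzy⟩ := D.inter (hα v hv).1 hadj' ((hS v hv).2.1 hzS) hz' hne
    rcases hy with rfl | rfl
    · rcases hy' with h | h
      · exact absurd h (hαout v v' hv hv')
      · exact absurd h (hαout v w' hv hw')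
    · exact ⟨hy'.imp (fun h => hφ h) (fun h => hφ h), hzy⟩
  -- Tails could only meet at a common end of the old edges. The ends `α v` lie in the interior of
  -- `T`, whereas a tail meets `T` only in a point outside of this interior; the ends `φ v` are
  -- distinct.
  have disS : ∀ v w z, G'.Adj c v → G'.Adj c w → v ≠ w → z ∈ S v → z ∉ S w := by
    intro v w z hv hw hvw hz hz'
    have hne : s(α v, φ v) ≠ s(α w, φ w) := by
      intro he
      rcases Sym2.eq_iff.1 he with ⟨-, h⟩ | ⟨h, -⟩
      · exact hvw (hφ h)
      · exact hαout v w hv hw.ne' h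
    obtain ⟨y, hy, hy', hzy⟩ :=
      D.inter (hα v hv).1 (hα w hw).1 ((hS v hv).2.1 hz) ((hS w hw).2.1 hz') hne
    rcases hy with rfl | rfl
    · have hz1 : z ∈ interior T := hzy ▸ (hα v hv).2
      have hz2 : z = x v := (hS v hv).2.2.2.2 ⟨hz, hint hz1⟩
      exact (hS v hv).2.2.2.1 (hz2 ▸ hz1)
    · rcases hy' with h | h
      · exact hαout w v hw hv.ne' h.symm
      · exact hvw (hφ h)
  have xne : ∀ v w, G'.Adj c v → G'.Adj c w → v ≠ w → x v ≠ x w := fun v w hv hw hvw h =>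
    disS v w (x v) hv hw hvw (hS v hv).1.left_mem (by rw [h]; exact (hS w hw).1.left_mem)
  have interS : ∀ v w z, G'.Adj c v → G'.Adj c w → v ≠ w → z ∈ segment ℝ m (x v) → z ∈ A w →
      z = m := by
    intro v w z hv hw hvw hz hz'
    have hzw : z ∈ segment ℝ m (x w) := by
      rcases hz' with h | h
      · exact h
      · have : z = x w := (hS w hw).2.2.2.2 ⟨h, hseg v hv hz⟩
        rw [this]; exact right_mem_segment _ _ _
    exact segment_inter_of_notMem_interior hconv hm (hS v hv).2.2.1 (hS w hw).2.2.1
      (hS v hv).2.2.2.1 (hS w hw).2.2.2.1 (xne v w hv hw hvw) hz hzw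
  have interAA : ∀ v w z, G'.Adj c v → G'.Adj c w → v ≠ w → z ∈ A v → z ∈ A w → z = m := by
    intro v w z hv hw hvw hz hz'
    rcases hz with h | h
    · exact interS v w z hv hw hvw h hz'
    · rcases hz' with h' | h'
      · exact interS w v z hw hv hvw.symm h' (Or.inr h)
      · exact absurd h' (disS v w z hv hw hvw h)
  have mpos : ∀ v, v ≠ c → D.pos (φ v) ≠ m := fun v hv h => hout v hv (h ▸ hint hm)
  set pos : V' → Plane := fun v => if v = c then m else D.pos (φ v) with hpos
  set arc : V' → V' → Set Plane := fun v w =>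
    if v = c then A w else if w = c then A v else D.arc (φ v) (φ w) with harc
  have posc : pos c = m := if_pos rfl
  have posn : ∀ v, v ≠ c → pos v = D.pos (φ v) := fun v hv => if_neg hv
  have arcc : ∀ v, arc c v = A v := fun v => if_pos rfl
  have arcc' : ∀ v, arc v c = A v := by
    intro v
    by_cases h : v = c
    · rw [h, arcc]
    · simp only [harc, if_neg h, if_pos]
  have arcn : ∀ v w, v ≠ c → w ≠ c → arc v w = D.arc (φ v) (φ w) := fun v w hv hw => by
    simp only [harc, if_neg hv, if_neg hw]
  have arc_symm : ∀ v w, arc v w = arc w v := by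
    intro v w
    by_cases hv : v = c
    · rw [hv, arcc, arcc']
    · by_cases hw : w = c
      · rw [hw, arcc, arcc']
      · rw [arcn v w hv hw, arcn w v hw hv, D.arc_symm]
  have inter_c : ∀ v u' v' z, G'.Adj c v → G'.Adj u' v' → z ∈ A v → z ∈ arc u' v' →
      s(c, v) ≠ s(u', v') → ∃ y, (y = c ∨ y = v) ∧ (y = u' ∨ y = v') ∧ z = pos y := by
    intro v u' v' z hv h hz hz' hne
    by_cases hu' : u' = c
    · subst hu'
      rw [arcc] at hz'
      have hvv : v ≠ v' := fun h => hne (by rw [h])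
      exact ⟨u', Or.inl rfl, Or.inl rfl, (interAA v v' z hv h hvv hz hz').trans posc.symm⟩
    · by_cases hv' : v' = c
      · subst hv'
        rw [arcc'] at hz'
        have hvv : v ≠ u' := fun h => hne (by rw [h, Sym2.eq_swap])
        exact ⟨v', Or.inl rfl, Or.inr rfl, (interAA v u' z hv h.symm hvv hz hz').trans posc.symm⟩
      · rw [arcn u' v' hu' hv'] at hz'
        obtain ⟨h1, h2⟩ := interA v u' v' z hv hu' hv' h hz hz'
        exact ⟨v, Or.inr rfl, h1, h2.trans (posn v hv.ne').symm⟩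
  refine ⟨⟨pos, arc, ?_, arc_symm, ?_, ?_, ?_⟩, posc, posn, arcn, arcc⟩
  · intro v w h
    by_cases hv : v = c
    · by_cases hw : w = c
      · rw [hv, hw]
      · rw [hv, posc, posn w hw] at h
        exact absurd h.symm (mpos w hw)
    · by_cases hw : w = c
      · rw [hw, posc, posn v hv] at h
        exact absurd h (mpos v hv)
      · rw [posn v hv, posn w hw] at h
        exact hφ (D.pos_injective h)
  · intro u v h
    by_cases hu : u = c
    · subst hu
      rw [arcc, posc, posn v h.ne']
      exact arcA v h
    · by_cases hv : v = c
      · subst hv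
        rw [arcc', posc, posn u hu]
        exact (arcA u h.symm).symm
      · rw [arcn u v hu hv, posn u hu, posn v hv]
        exact D.isArc (hadj u v hu hv h).1
  · intro u v w h hw
    by_cases hu : u = c
    · by_cases hwc : w = c
      · exact Or.inl (hwc.trans hu.symm)
      · rw [hu, arcc, posn w hwc] at hw
        exact Or.inr (memA v w (hu ▸ h) hwc hw)
    · by_cases hv : v = c
      · by_cases hwc : w = c
        · exact Or.inr (hwc.trans hv.symm)
        · rw [hv, arcc', posn w hwc] at hw
          exact Or.inl (memA u w (hv ▸ h.symm) hwc hw)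
      · obtain ⟨h1, h2⟩ := hadj u v hu hv h
        rw [arcn u v hu hv] at hw
        by_cases hwc : w = c
        · rw [hwc, posc] at hw
          exact absurd (hint hm) (Set.disjoint_left.1 h2 hw)
        · rw [posn w hwc] at hw
          exact (D.mem_arc h1 hw).imp (fun h => hφ h) (fun h => hφ h)
  · intro u v u' v' z h h' hz hz' hne
    by_cases hu : u = c
    · rw [hu, arcc] at hz
      rw [hu] at hne h ⊢
      exact inter_c v u' v' z h h' hz hz' hne
    by_cases hv : v = c
    · rw [hv, arcc'] at hz
      rw [hv] at hne h ⊢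
      obtain ⟨y, h1, h2, h3⟩ := inter_c u u' v' z h.symm h' hz hz' (by rwa [Sym2.eq_swap])
      exact ⟨y, h1.symm, h2, h3⟩
    by_cases hu' : u' = c
    · rw [hu', arcc] at hz'
      rw [hu'] at hne h' ⊢
      obtain ⟨y, h1, h2, h3⟩ := inter_c v' u v z h' h hz' hz hne.symm
      exact ⟨y, h2, h1, h3⟩
    by_cases hv' : v' = c
    · rw [hv', arcc'] at hz'
      rw [hv'] at hne h' ⊢
      obtain ⟨y, h1, h2, h3⟩ := inter_c u' u v z h'.symm h hz' hz
        (by rw [Sym2.eq_swap]; exact hne.symm)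
      exact ⟨y, h2, h1.symm, h3⟩
    rw [arcn u v hu hv] at hz
    rw [arcn u' v' hu' hv'] at hz'
    have hne' : s(φ u, φ v) ≠ s(φ u', φ v') := by
      intro he
      apply hne
      rcases Sym2.eq_iff.1 he with ⟨h1, h2⟩ | ⟨h1, h2⟩
      · rw [hφ h1, hφ h2]
      · rw [hφ h1, hφ h2, Sym2.eq_swap]
    obtain ⟨y, hy, hy', hzy⟩ :=
      D.inter (hadj u v hu hv h).1 (hadj u' v' hu' hv' h').1 hz hz' hne'
    rcases hy with rfl | rfl
    · exact ⟨u, Or.inl rfl, hy'.imp (fun h => hφ h) (fun h => hφ h), hzy.trans (posn u hu).symm⟩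
    · exact ⟨v, Or.inr rfl, hy'.imp (fun h => hφ h) (fun h => hφ h), hzy.trans (posn v hv).symm⟩

/-- Every edge with exactly one end in the interior of a closed set `T` has a last point in it. -/
lemma exists_exits (D : Drawing G) {G' : SimpleGraph V'} {φ : V' → V} (c : V') {T : Set Plane}
    (hT : IsClosed T) (hout : ∀ v, v ≠ c → D.pos (φ v) ∉ T) (α : V' → V)
    (hα : ∀ v, G'.Adj c v → G.Adj (α v) (φ v) ∧ D.pos (α v) ∈ interior T) :
    ∃ (x : V' → Plane) (S : V' → Set Plane),
      ∀ v, G'.Adj c v → IsArc (x v) (D.pos (φ v)) (S v) ∧ S v ⊆ D.arc (α v) (φ v) ∧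
        x v ∈ T ∧ x v ∉ interior T ∧ S v ∩ T ⊆ {x v} := by
  have key : ∀ v, ∃ (p : Plane) (S : Set Plane), G'.Adj c v → IsArc p (D.pos (φ v)) S ∧
      S ⊆ D.arc (α v) (φ v) ∧ p ∈ T ∧ p ∉ interior T ∧ S ∩ T ⊆ {p} := by
    intro v
    by_cases h : G'.Adj c v
    · obtain ⟨p, S, hp⟩ := (D.isArc (hα v h).1).last_exit hT (interior_subset (hα v h).2)
        (hout v h.ne')
      exact ⟨p, S, fun _ => hp⟩
    · exact ⟨0, ∅, fun h' => absurd h' h⟩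
  choose x S h using key
  exact ⟨x, S, h⟩

/-- The part of a drawing that is not touched if the vertex `b` is moved. -/
def fixedPart (D : Drawing G) (b : V) : Set Plane :=
  {p | (∃ v, v ≠ b ∧ p = D.pos v) ∨ ∃ v w, v ≠ b ∧ w ≠ b ∧ G.Adj v w ∧ p ∈ D.arc v w}

/-- `D'` differs from `D` only by the position of `b` and the edges at `b`. -/
def IsMoveOf (D' D : Drawing G) (b : V) : Prop :=
  (∀ v, v ≠ b → D'.pos v = D.pos v) ∧ ∀ v w, v ≠ b → w ≠ b → D'.arc v w = D.arc v w

lemma IsMoveOf.fixedPart_eq {D D' : Drawing G} {b : V} (h : D'.IsMoveOf D b) :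
    D'.fixedPart b = D.fixedPart b := by
  ext p
  refine or_congr (exists_congr fun v => and_congr_right fun hv => by rw [h.1 v hv])
    (exists_congr fun v => exists_congr fun w => and_congr_right fun hv =>
      and_congr_right fun hw => by rw [h.2 v w hv hw])

lemma IsMoveOf.trans {D D' D'' : Drawing G} {b : V} (h : D''.IsMoveOf D' b) (h' : D'.IsMoveOf D b) :
    D''.IsMoveOf D b :=
  ⟨fun v hv => (h.1 v hv).trans (h'.1 v hv), fun v w hv hw => (h.2 v w hv hw).trans (h'.2 v w hv hw)⟩

lemma isClosed_fixedPart [Finite V] (D : Drawing G) (b : V) : IsClosed (D.fixedPart b) := by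
  have : D.fixedPart b = (⋃ v, ⋃ (_ : v ≠ b), {D.pos v}) ∪
      ⋃ v, ⋃ w, ⋃ (_ : v ≠ b ∧ w ≠ b ∧ G.Adj v w), D.arc v w := by
    ext p
    simp only [fixedPart, Set.mem_ofPred_eq, Set.mem_union, Set.mem_iUnion, exists_prop, and_assoc,
      Set.mem_singleton_iff]
  rw [this]
  refine IsClosed.union ?_ ?_
  · exact isClosed_iUnion_of_finite fun v => isClosed_iUnion_of_finite fun _ => isClosed_singleton
  · exact isClosed_iUnion_of_finite fun v => isClosed_iUnion_of_finite fun w =>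
      isClosed_iUnion_of_finite fun h => (D.isArc h.2.2).isCompact.isClosed

/-- This is the star construction with `α` constantly `b`: each edge at `b` keeps only what follows
its last point in `T`, so the centre can be placed anywhere in the interior. -/
lemma exists_move_of_convex (D : Drawing G) (b : V) {T : Set Plane} (hT : IsClosed T)
    (hconv : Convex ℝ T) (hdis : Disjoint (D.fixedPart b) T) (hb : D.pos b ∈ interior T) {m : Plane}
    (hm : m ∈ interior T) : ∃ D' : Drawing G, D'.pos b = m ∧ D'.IsMoveOf D b := by
  have hout : ∀ v, v ≠ b → D.pos (id v) ∉ T := fun v hv =>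
    Set.disjoint_left.1 hdis (Or.inl ⟨v, hv, rfl⟩)
  have hα : ∀ v, G.Adj b v → G.Adj ((fun _ => b) v) (id v) ∧ D.pos ((fun _ => b) v) ∈ interior T :=
    fun v hv => ⟨hv, hb⟩
  obtain ⟨x, S, hS⟩ := D.exists_exits (G' := G) (φ := id) b hT hout _ hα
  obtain ⟨D', h1, h2, h3, -⟩ := D.exists_star (G' := G) Function.injective_id b hconv hm hout
    (fun v w hv hw h => ⟨h, Set.disjoint_left.2 fun p hp =>
      Set.disjoint_left.1 hdis (Or.inr ⟨v, w, hv, hw, h, hp⟩)⟩) _ hα x S hS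
  exact ⟨D', h1, h2, h3⟩

/-- A vertex can be moved along every connected set that avoids the rest of the drawing. -/
theorem exists_move [Finite V] (D : Drawing G) (b : V) {K : Set Plane} (hK : IsPreconnected K)
    (hdis : Disjoint (D.fixedPart b) K) (hb : D.pos b ∈ K) {m : Plane} (hm : m ∈ K) :
    ∃ D' : Drawing G, D'.pos b = m ∧ D'.IsMoveOf D b := by
  set R : Plane → Prop := fun m => ∃ D' : Drawing G, D'.pos b = m ∧ D'.IsMoveOf D b with hR
  -- Off the fixed part, both reachability and its failure spread to a small ball, so both define
  -- open sets; the connected set `K` cannot meet the two of them.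
  have hloc : ∀ p, p ∉ D.fixedPart b → ∃ ε > 0, ∀ q ∈ Metric.ball p ε, ∀ q' ∈ Metric.ball p ε,
      R q → R q' := by
    intro p hp
    obtain ⟨ε, hε, hsub⟩ := Metric.nhds_basis_closedBall.mem_iff.1
      ((D.isClosed_fixedPart b).isOpen_compl.mem_nhds hp)
    refine ⟨ε, hε, fun q hq q' hq' ⟨D', hD', hmv⟩ => ?_⟩
    obtain ⟨D'', h1, h2⟩ := D'.exists_move_of_convex b Metric.isClosed_closedBall
      (convex_closedBall p ε)
      (by rw [hmv.fixedPart_eq]; exact Set.disjoint_left.2 fun z hz hz' => hsub hz' hz)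
      (Metric.ball_subset_interior_closedBall (hD' ▸ hq)) (Metric.ball_subset_interior_closedBall hq')
    exact ⟨D'', h1, h2.trans hmv⟩
  have hopen : ∀ Q : Plane → Prop, (∀ p, p ∉ D.fixedPart b → ∃ ε > 0, ∀ q ∈ Metric.ball p ε,
      ∀ q' ∈ Metric.ball p ε, Q q → Q q') → IsOpen {p | p ∉ D.fixedPart b ∧ Q p} := by
    intro Q hQ
    rw [isOpen_iff_mem_nhds]
    rintro p ⟨hp, hp'⟩
    obtain ⟨ε, hε, h⟩ := hQ p hp
    filter_upwards [Metric.ball_mem_nhds p hε, (D.isClosed_fixedPart b).isOpen_compl.mem_nhds hp]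
      with q hq hq'
    exact ⟨hq', h p (Metric.mem_ball_self hε) q hq hp'⟩
  by_contra hcon
  have hneg : IsOpen {p | p ∉ D.fixedPart b ∧ ¬ R p} := hopen (fun p => ¬ R p) fun p hp => by
    obtain ⟨ε, hε, h⟩ := hloc p hp
    exact ⟨ε, hε, fun q hq q' hq' hn hR => hn (h q' hq' q hq hR)⟩
  obtain ⟨p, -, h1, h2⟩ := hK _ _ (hopen R hloc) hneg
    (fun p hp => by
      have := Set.disjoint_right.1 hdis hp
      by_cases h : R p
      · exact Or.inl ⟨this, h⟩
      · exact Or.inr ⟨this, h⟩)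
    ⟨D.pos b, hb, Set.disjoint_right.1 hdis hb, D, rfl, fun _ _ => rfl, fun _ _ _ _ => rfl⟩
    ⟨m, hm, Set.disjoint_right.1 hdis hm, hcon⟩
  exact h2.2 h1.2

/-- Contracting the edge between `none` and `some y` preserves the existence of drawings. -/
theorem nonempty_contract [Finite V] {H : SimpleGraph (Option V)} {y : V} (hy : H.Adj none (some y))
    (hG : ∀ i j, G.Adj i j → H.Adj (some i) (some j) ∨ (i = y ∧ H.Adj none (some j)) ∨
      (j = y ∧ H.Adj none (some i))) (D : Drawing H) : Nonempty (Drawing G) := by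
  classical
  set F : Set Plane := {p | (∃ v, v ≠ y ∧ p = D.pos (some v)) ∨
    ∃ v w, v ≠ y ∧ w ≠ y ∧ H.Adj (some v) (some w) ∧ p ∈ D.arc (some v) (some w)} with hF
  have hFclosed : IsClosed F := by
    have : F = (⋃ v, ⋃ (_ : v ≠ y), {D.pos (some v)}) ∪
        ⋃ v, ⋃ w, ⋃ (_ : v ≠ y ∧ w ≠ y ∧ H.Adj (some v) (some w)), D.arc (some v) (some w) := by
      ext p
      simp only [hF, Set.mem_ofPred_eq, Set.mem_union, Set.mem_iUnion, exists_prop, and_assoc,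
        Set.mem_singleton_iff]
    rw [this]
    refine IsClosed.union ?_ ?_
    · exact isClosed_iUnion_of_finite fun v => isClosed_iUnion_of_finite fun _ => isClosed_singleton
    · exact isClosed_iUnion_of_finite fun v => isClosed_iUnion_of_finite fun w =>
        isClosed_iUnion_of_finite fun h => (D.isArc h.2.2).isCompact.isClosed
  have hyF : D.pos (some y) ∉ F := by
    rintro (⟨v, hv, h⟩ | ⟨v, w, hv, hw, hvw, h⟩)
    · exact hv (Option.some_injective _ (D.pos_injective h)).symm
    · rcases D.mem_arc hvw h with h | h
      · exact hv (Option.some_injective _ h).symm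
      · exact hw (Option.some_injective _ h).symm
  obtain ⟨ε, hε, hsub⟩ := Metric.nhds_basis_closedBall.mem_iff.1 (hFclosed.isOpen_compl.mem_nhds hyF)
  set T := Metric.closedBall (D.pos (some y)) ε with hT
  -- The vertex `none` slides along its edge towards `y` until both are in the disc `T`, from which
  -- all other vertices, and all edges avoiding both, are absent.
  obtain ⟨p, K, hK, hbK, hpK, hyK, hKS, hpT⟩ :=
    (D.isArc hy).approach (Metric.ball_mem_nhds (D.pos (some y)) hε)
  have hdis : Disjoint (D.fixedPart none) K := by
    rw [Set.disjoint_left]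
    intro q hq hqK
    rcases hq with ⟨v, hv, rfl⟩ | ⟨v, w, hv, hw, hvw, h⟩
    · rcases D.mem_arc hy (hKS hqK) with h | h
      · exact hv h
      · exact hyK (h ▸ hqK)
    · obtain ⟨z, hz, hz', hq⟩ := D.inter hy hvw (hKS hqK) h (by
        intro he
        rcases Sym2.eq_iff.1 he with ⟨h, -⟩ | ⟨h, -⟩
        · exact hv h.symm
        · exact hw h.symm)
      rcases hz with rfl | rfl
      · rcases hz' with h | h
        · exact hv h.symm
        · exact hw h.symm
      · exact hyK (hq ▸ hqK)
  obtain ⟨D', hp, hmv1, hmv2⟩ := D.exists_move none hK hdis hbK hpK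
  have hyT : D'.pos (some y) ∈ interior T := by
    rw [hmv1 _ (by simp)]
    exact Metric.ball_subset_interior_closedBall (Metric.mem_ball_self hε)
  have hnT : D'.pos none ∈ interior T := by
    rw [hp]
    exact Metric.ball_subset_interior_closedBall hpT
  have hout : ∀ v, v ≠ y → D'.pos (some v) ∉ T := by
    intro v hv h
    rw [hmv1 _ (by simp)] at h
    exact hsub h (Or.inl ⟨v, hv, rfl⟩)
  -- If `v` is adjacent to both merged vertices, only the edge from `y` is kept.
  set α : V → Option V := fun v => if H.Adj (some y) (some v) then some y else none with hα
  have hα' : ∀ v, G.Adj y v → H.Adj (α v) (some v) ∧ D'.pos (α v) ∈ interior T := by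
    intro v hv
    by_cases h : H.Adj (some y) (some v)
    · simp only [hα, if_pos h]; exact ⟨h, hyT⟩
    · simp only [hα, if_neg h]
      refine ⟨?_, hnT⟩
      rcases hG y v hv with h' | ⟨-, h'⟩ | ⟨h', -⟩
      · exact absurd h' h
      · exact h'
      · exact absurd h' hv.ne'
  obtain ⟨x, S, hS⟩ := D'.exists_exits (G' := G) (φ := some) y Metric.isClosed_closedBall hout α hα'
  obtain ⟨D'', -⟩ := D'.exists_star (G' := G) (Option.some_injective _) y (convex_closedBall _ _) hyT
    hout (fun v w hv hw h => by
      have hvw : H.Adj (some v) (some w) := by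
        rcases hG v w h with h' | ⟨h', -⟩ | ⟨h', -⟩
        · exact h'
        · exact absurd h' hv
        · exact absurd h' hw
      refine ⟨hvw, Set.disjoint_left.2 fun q hq hqT => ?_⟩
      rw [hmv2 _ _ (by simp) (by simp)] at hq
      exact hsub hqT (Or.inr ⟨v, w, hv, hw, hvw, hq⟩)) α hα' x S hS
  exact ⟨D''⟩

end Drawing

/-! ### Adding an edge to a drawing. -/

/-- Two compact sets are joined by a segment that meets them only at its ends. -/
lemma exists_segment_of_isCompact {A B : Set Plane} (hA : IsCompact A) (hB : IsCompact B)
    (hA' : A.Nonempty) (hB' : B.Nonempty) :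
    ∃ p ∈ A, ∃ q ∈ B, ∀ x ∈ segment ℝ p q, x ∈ A ∨ x ∈ B → x = p ∨ x = q := by
  -- Take a pair at minimal distance: a further point of either set on the segment would give a
  -- closer pair.
  obtain ⟨z, hz, hmin⟩ := (hA.prod hB).exists_isMinOn (hA'.prod hB') continuous_dist.continuousOn
  have hmin' : ∀ p' ∈ A, ∀ q' ∈ B, dist z.1 z.2 ≤ dist p' q' := fun p' hp' q' hq' =>
    isMinOn_iff.1 hmin (p', q') ⟨hp', hq'⟩
  refine ⟨z.1, hz.1, z.2, hz.2, fun x hx hx' => ?_⟩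
  have hsum := dist_add_dist_of_mem_segment hx
  rcases hx' with h | h
  · left
    have := hmin' x h z.2 hz.2
    exact (dist_le_zero.1 (by linarith)).symm
  · right
    have := hmin' z.1 hz.1 x h
    exact dist_le_zero.1 (by linarith)

namespace Drawing

variable {V : Type*} {G : SimpleGraph V}

/-- `S` meets the drawing at most in the points `p` and `q`. -/
def IsFree (D : Drawing G) (p q : Plane) (S : Set Plane) : Prop :=
  (∀ v, D.pos v ∈ S → D.pos v = p ∨ D.pos v = q) ∧
    ∀ u v, G.Adj u v → ∀ x ∈ D.arc u v, x ∈ S → x = p ∨ x = q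

lemma nonempty_sup_edge (D : Drawing G) {a b : V} {S : Set Plane}
    (hS : IsArc (D.pos a) (D.pos b) S) (hfree : D.IsFree (D.pos a) (D.pos b) S) :
    Nonempty (Drawing (G ⊔ SimpleGraph.edge a b)) := by
  classical
  -- If `a` and `b` are already adjacent, `S` replaces the old arc.
  set arc : V → V → Set Plane := fun u v => if s(u, v) = s(a, b) then S else D.arc u v with harc
  have arc1 : ∀ {u v}, s(u, v) = s(a, b) → arc u v = S := fun h => if_pos h
  have arc2 : ∀ {u v}, s(u, v) ≠ s(a, b) → arc u v = D.arc u v := fun h => if_neg h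
  have adj : ∀ {u v}, (G ⊔ SimpleGraph.edge a b).Adj u v → s(u, v) ≠ s(a, b) → G.Adj u v := by
    intro u v h hne
    rw [SimpleGraph.sup_adj, SimpleGraph.edge_adj] at h
    rcases h with h | ⟨h, -⟩
    · exact h
    · exact absurd (Sym2.eq_iff.2 h) hne
  have key : ∀ {u v u' v' x}, s(u, v) = s(a, b) → G.Adj u' v' → x ∈ S → x ∈ D.arc u' v' →
      ∃ z, (z = u ∨ z = v) ∧ (z = u' ∨ z = v') ∧ x = D.pos z := by
    intro u v u' v' x he h' hx hx'
    rcases hfree.2 u' v' h' x hx' hx with rfl | rfl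
    · refine ⟨a, ?_, D.mem_arc h' hx', rfl⟩
      rw [← Sym2.mem_iff, he]; exact Sym2.mem_mk_left _ _
    · refine ⟨b, ?_, D.mem_arc h' hx', rfl⟩
      rw [← Sym2.mem_iff, he]; exact Sym2.mem_mk_right _ _
  refine ⟨⟨D.pos, arc, D.pos_injective, ?_, ?_, ?_, ?_⟩⟩
  · intro u v
    simp only [harc]
    rw [Sym2.eq_swap, D.arc_symm]
  · intro u v h
    by_cases he : s(u, v) = s(a, b)
    · rw [arc1 he]
      rcases Sym2.eq_iff.1 he with ⟨rfl, rfl⟩ | ⟨rfl, rfl⟩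
      · exact hS
      · exact hS.symm
    · rw [arc2 he]
      exact D.isArc (adj h he)
  · intro u v w h hw
    by_cases he : s(u, v) = s(a, b)
    · rw [arc1 he] at hw
      rw [← Sym2.mem_iff, he, Sym2.mem_iff]
      exact (hfree.1 w hw).imp (fun h => D.pos_injective h) (fun h => D.pos_injective h)
    · rw [arc2 he] at hw
      exact D.mem_arc (adj h he) hw
  · intro u v u' v' x h h' hx hx' hne
    by_cases he : s(u, v) = s(a, b)
    · have he' : s(u', v') ≠ s(a, b) := fun h => hne (he.trans h.symm)
      rw [arc1 he] at hx
      rw [arc2 he'] at hx'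
      exact key he (adj h' he') hx hx'
    · rw [arc2 he] at hx
      by_cases he' : s(u', v') = s(a, b)
      · rw [arc1 he'] at hx'
        obtain ⟨z, h1, h2, h3⟩ := key he' (adj h he) hx' hx
        exact ⟨z, h2, h1, h3⟩
      · rw [arc2 he'] at hx'
        exact D.inter (adj h he) (adj h' he') hx hx' hne

/-- A point of an edge can be made a vertex. -/
theorem exists_subdivision (D : Drawing G) {u v : V} (huv : G.Adj u v) {p : Plane}
    (hp : p ∈ D.arc u v) (hpu : p ≠ D.pos u) (hpv : p ≠ D.pos v) :
    ∃ (H : SimpleGraph (Option V)) (D' : Drawing H), D'.pos none = p ∧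
      (∀ i, D'.pos (some i) = D.pos i) ∧ H.Adj none (some u) ∧ H.Adj none (some v) ∧
      (∀ i j, G.Adj i j → s(i, j) ≠ s(u, v) →
        H.Adj (some i) (some j) ∧ D'.arc (some i) (some j) = D.arc i j) ∧
      ∀ i j, H.Adj i j → ∀ x ∈ D'.arc i j, ∃ i' j', G.Adj i' j' ∧ x ∈ D.arc i' j' := by
  classical
  -- `A i` is the half of the subdivided edge between `p` and its end `i`.
  obtain ⟨A, hA⟩ : ∃ A : V → Set Plane, ∀ i, i = u ∨ i = v → IsArc p (D.pos i) (A i) ∧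
      A i ⊆ D.arc u v ∧ (∀ j, j = u ∨ j = v → D.pos j ∈ A i → j = i) ∧
      ∀ j, j = u ∨ j = v → j ≠ i → A i ∩ A j ⊆ {p} := by
    obtain ⟨S₁, S₂, h1, h2, h3, h4⟩ := (D.isArc huv).split hp hpu hpv
    refine ⟨fun i => if i = u then S₁ else S₂, fun i hi => ?_⟩
    beta_reduce
    rcases hi with rfl | rfl
    · refine ⟨by simpa using h1.symm, by simp [← h4], ?_, ?_⟩
      · rintro j (rfl | rfl) hj
        · rfl
        · rw [if_pos rfl] at hj
          exact absurd (h3 ⟨hj, h2.right_mem⟩).symm hpv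
      · rintro j (rfl | rfl) hj
        · exact absurd rfl hj
        · simpa [huv.ne'] using h3
    · refine ⟨by simpa [huv.ne'] using h2, by simp [← h4, huv.ne'], ?_, ?_⟩
      · rintro j (rfl | rfl) hj
        · rw [if_neg huv.ne'] at hj
          exact absurd (h3 ⟨h1.left_mem, hj⟩).symm hpu
        · rfl
      · rintro j (rfl | rfl) hj
        · rw [if_neg huv.ne', if_pos rfl, Set.inter_comm]; exact h3
        · exact absurd rfl hj
  have hpn : ∀ i, D.pos i ≠ p := by
    rintro i rfl
    rcases D.mem_arc huv hp with rfl | rfl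
    · exact hpu rfl
    · exact hpv rfl
  have arcA : ∀ i k l x, i = u ∨ i = v → G.Adj k l → s(k, l) ≠ s(u, v) → x ∈ A i →
      x ∈ D.arc k l → (i = k ∨ i = l) ∧ x = D.pos i := by
    intro i k l x hi hkl hne hx hx'
    obtain ⟨z, hz, hz', rfl⟩ := D.inter huv hkl ((hA i hi).2.1 hx) hx' hne.symm
    have := (hA i hi).2.2.1 z hz hx
    subst this
    exact ⟨hz', rfl⟩
  set H : SimpleGraph (Option V) :=
    { Adj := fun i j => match i, j with
        | none, none => False
        | none, some j => j = u ∨ j = v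
        | some i, none => i = u ∨ i = v
        | some i, some j => G.Adj i j ∧ s(i, j) ≠ s(u, v)
      symm := ⟨by
        rintro (_ | i) (_ | j) h
        · exact h
        · exact h
        · exact h
        · exact ⟨h.1.symm, by rw [Sym2.eq_swap]; exact h.2⟩⟩
      loopless := ⟨by
        rintro (_ | i) h
        · exact h
        · exact h.1.ne rfl⟩ } with hH
  set arc : Option V → Option V → Set Plane := fun i j => match i, j with
    | none, none => ∅
    | none, some j => A j
    | some i, none => A i
    | some i, some j => D.arc i j with harc
  set pos : Option V → Plane := fun i => i.elim p D.pos with hpos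
  have key1 : ∀ i k l x, i = u ∨ i = v → G.Adj k l → s(k, l) ≠ s(u, v) → x ∈ A i →
      x ∈ D.arc k l → ∃ z, (z = none ∨ z = some i) ∧ (z = some k ∨ z = some l) ∧ x = pos z := by
    intro i k l x hi hkl hne hx hx'
    obtain ⟨h1, h2⟩ := arcA i k l x hi hkl hne hx hx'
    exact ⟨some i, Or.inr rfl, h1.imp (congrArg some) (congrArg some), h2⟩
  have key2 : ∀ i j x, i = u ∨ i = v → j = u ∨ j = v → j ≠ i → x ∈ A i → x ∈ A j → x = pos none :=
    fun i j x hi hj hne hx hx' => (hA i hi).2.2.2 j hj hne ⟨hx, hx'⟩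
  refine ⟨H, ⟨pos, arc, ?_, ?_, ?_, ?_, ?_⟩, rfl, fun i => rfl, Or.inl rfl, Or.inr rfl,
    fun i j h hne => ⟨⟨h, hne⟩, rfl⟩, ?_⟩
  · rintro (_ | i) (_ | j) h
    · rfl
    · exact absurd h.symm (hpn j)
    · exact absurd h (hpn i)
    · exact congrArg some (D.pos_injective h)
  · rintro (_ | i) (_ | j)
    · rfl
    · rfl
    · rfl
    · exact D.arc_symm i j
  · rintro (_ | i) (_ | j) h
    · exact h.elim
    · exact (hA j h).1
    · exact (hA i h).1.symm
    · exact D.isArc h.1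
  · have hv : ∀ i w, i = u ∨ i = v → D.pos w ∈ A i → w = i := fun i w hi hw =>
      (hA i hi).2.2.1 w (D.mem_arc huv ((hA i hi).2.1 hw)) hw
    rintro (_ | i) (_ | j) (_ | w) h hw
    · exact Or.inl rfl
    · exact h.elim
    · exact Or.inl rfl
    · exact Or.inr (congrArg some (hv j w h hw))
    · exact Or.inr rfl
    · exact Or.inl (congrArg some (hv i w h hw))
    · obtain ⟨z, -, -, hz⟩ := D.inter huv h.1 hp hw h.2.symm
      exact absurd hz.symm (hpn z)
    · exact (D.mem_arc h.1 hw).imp (congrArg some) (congrArg some)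
  · rintro (_ | i) (_ | j) (_ | k) (_ | l) x h h' hx hx' hne
    · exact h.elim
    · exact h.elim
    · exact h.elim
    · exact h.elim
    · exact h'.elim
    · exact ⟨none, Or.inl rfl, Or.inl rfl,
        key2 j l x h h' (fun e => hne (by rw [e])) hx hx'⟩
    · exact ⟨none, Or.inl rfl, Or.inr rfl,
        key2 j k x h h' (fun e => hne (by rw [e, Sym2.eq_swap])) hx hx'⟩
    · exact key1 j k l x h h'.1 h'.2 hx hx'
    · exact h'.elim
    · exact ⟨none, Or.inr rfl, Or.inl rfl,
        key2 i l x h h' (fun e => hne (by rw [e, Sym2.eq_swap])) hx hx'⟩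
    · exact ⟨none, Or.inr rfl, Or.inr rfl,
        key2 i k x h h' (fun e => hne (by rw [e])) hx hx'⟩
    · obtain ⟨z, h1, h2, h3⟩ := key1 i k l x h h'.1 h'.2 hx hx'
      exact ⟨z, h1.symm, h2, h3⟩
    · exact h'.elim
    · obtain ⟨z, h1, h2, h3⟩ := key1 l i j x h' h.1 h.2 hx' hx
      exact ⟨z, h2, h1, h3⟩
    · obtain ⟨z, h1, h2, h3⟩ := key1 k i j x h' h.1 h.2 hx' hx
      exact ⟨z, h2, h1.symm, h3⟩
    · obtain ⟨z, h1, h2, h3⟩ := D.inter h.1 h'.1 hx hx' (fun e => hne (by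
        rcases Sym2.eq_iff.1 e with ⟨rfl, rfl⟩ | ⟨rfl, rfl⟩
        · rfl
        · exact Sym2.eq_swap))
      exact ⟨some z, h1.imp (congrArg some) (congrArg some),
        h2.imp (congrArg some) (congrArg some), h3⟩
  · rintro (_ | i) (_ | j) h x hx
    · exact h.elim
    · exact ⟨u, v, huv, (hA j h).2.1 hx⟩
    · exact ⟨u, v, huv, (hA i h).2.1 hx⟩
    · exact ⟨i, j, h.1, hx⟩

/-- Contraction of the new vertex `none`, adjacent to `some c`, in a subdivision with an additional
edge between `none` and `some b`. -/
lemma nonempty_contract_subdivision [Finite V] {H : SimpleGraph (Option V)} {b c v : V}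
    (hc : H.Adj none (some c)) (hv : H.Adj none (some v)) (hbc : b ≠ c)
    (hG : ∀ i j, G.Adj i j → s(i, j) ≠ s(c, v) → H.Adj (some i) (some j))
    (D : Drawing (H ⊔ SimpleGraph.edge none (some b))) :
    Nonempty (Drawing (G ⊔ SimpleGraph.edge c b)) := by
  refine nonempty_contract (y := c) (Or.inl hc) ?_ D
  intro i j h
  rw [SimpleGraph.sup_adj, SimpleGraph.edge_adj] at h
  rcases h with h | ⟨⟨rfl, rfl⟩ | ⟨rfl, rfl⟩, -⟩
  -- The subdivided edge `cv` reappears because `none`, which is adjacent to `v`, is merged into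
  -- `c`.
  · by_cases he : s(i, j) = s(c, v)
    · rcases Sym2.eq_iff.1 he with ⟨rfl, rfl⟩ | ⟨rfl, rfl⟩
      · exact Or.inr (Or.inl ⟨rfl, Or.inl hv⟩)
      · exact Or.inr (Or.inr ⟨rfl, Or.inl hv⟩)
    · exact Or.inl (Or.inl (hG i j h he))
  · refine Or.inr (Or.inl ⟨rfl, Or.inr ?_⟩)
    rw [SimpleGraph.edge_adj]; simp
  · refine Or.inr (Or.inr ⟨rfl, Or.inr ?_⟩)
    rw [SimpleGraph.edge_adj]; simp

/-- A subdivision covers no new points of the plane; the only new vertex is one of the two permitted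
points. -/
lemma IsFree.of_subdivision {H : SimpleGraph (Option V)} {D : Drawing G} {D' : Drawing H}
    {p q : Plane} {S : Set Plane} (h : D.IsFree p q S) (h0 : D'.pos none = p ∨ D'.pos none = q)
    (h1 : ∀ i, D'.pos (some i) = D.pos i)
    (h2 : ∀ i j, H.Adj i j → ∀ x ∈ D'.arc i j, ∃ i' j', G.Adj i' j' ∧ x ∈ D.arc i' j') :
    D'.IsFree p q S := by
  refine ⟨?_, fun i j hij x hx hxS => ?_⟩
  · rintro (_ | i) hi
    · exact h0
    · rw [h1] at hi ⊢
      exact h.1 i hi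
  · obtain ⟨i', j', h', hx'⟩ := h2 i j hij x hx
    exact h.2 i' j' h' x hx' hxS

/-- `q` is the vertex `y`, or a point of an edge at `y` other than `e`. -/
def IsPointAt (D : Drawing G) (y : V) (e : Sym2 V) (q : Plane) : Prop :=
  q = D.pos y ∨ ∃ v, G.Adj y v ∧ s(y, v) ≠ e ∧ q ∈ D.arc y v ∧ q ≠ D.pos y ∧ q ≠ D.pos v

/-- If `q` is inside an edge at `y`, it is made a vertex, joined to `a` along `S`, and then
contracted into `y`. -/
lemma nonempty_sup_edge_of_vertex [Finite V] (D : Drawing G) {a y : V} (hay : a ≠ y) {q : Plane}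
    {e : Sym2 V} (hq : D.IsPointAt y e q) {S : Set Plane} (hS : IsArc (D.pos a) q S)
    (hfree : D.IsFree (D.pos a) q S) : Nonempty (Drawing (G ⊔ SimpleGraph.edge a y)) := by
  rcases hq with rfl | ⟨v, hyv, -, hq, hqy, hqv⟩
  · exact D.nonempty_sup_edge hS hfree
  · obtain ⟨H, D', h0, h1, hy, hv, h2, h3⟩ := D.exists_subdivision hyv hq hqy hqv
    have hfree' := hfree.of_subdivision (Or.inr h0) h1 h3
    rw [SimpleGraph.edge_comm]
    rw [← h0, ← h1] at hS hfree'
    have hD := D'.nonempty_sup_edge hS hfree'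
    rw [SimpleGraph.edge_comm] at hD
    exact nonempty_contract_subdivision hy hv hay (fun i j h he => (h2 i j h he).1) hD.some

/-- Two vertices `a` and `y` can be joined by an additional edge if points of edges at these
vertices are joined by an arc that avoids the drawing. -/
theorem nonempty_sup_edge_of_isFree [Finite V] (D : Drawing G) {a v y : V} (hay : a ≠ y)
    (hav : G.Adj a v) {p q : Plane} (hp : p ∈ D.arc a v) (hpa : p ≠ D.pos a) (hpv : p ≠ D.pos v)
    (hq : D.IsPointAt y s(a, v) q) {S : Set Plane} (hS : IsArc p q S) (hfree : D.IsFree p q S) :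
    Nonempty (Drawing (G ⊔ SimpleGraph.edge a y)) := by
  obtain ⟨H, D', h0, h1, ha, hv, h2, h3⟩ := D.exists_subdivision hav hp hpa hpv
  have hfree' := hfree.of_subdivision (Or.inl h0) h1 h3
  rw [← h0] at hS hfree'
  -- The edge carrying `q` differs from `av`, so it survives the subdivision of `av` with the same
  -- arc.
  have hq' : D'.IsPointAt (some y) s(some a, some v) q := by
    rcases hq with rfl | ⟨w, hyw, hne, hq, hqy, hqw⟩
    · exact Or.inl (h1 y).symm
    · obtain ⟨h4, h5⟩ := h2 y w hyw hne
      refine Or.inr ⟨some w, h4, fun h => hne ?_, by rwa [h5], by rwa [h1], by rwa [h1]⟩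
      rw [Sym2.eq_iff] at h ⊢
      simpa using h
  obtain ⟨D''⟩ := D'.nonempty_sup_edge_of_vertex (by simp) hq' hS hfree'
  exact nonempty_contract_subdivision ha hv hay.symm (fun i j h he => (h2 i j h he).1) D''

/-- The part of a drawing that belongs to the edges and vertices that meet `C`. -/
def part (D : Drawing G) (C : Set V) : Set Plane :=
  {p | (∃ v ∈ C, p = D.pos v) ∨ ∃ v ∈ C, ∃ w, G.Adj v w ∧ p ∈ D.arc v w}

lemma isCompact_part [Finite V] (D : Drawing G) (C : Set V) : IsCompact (D.part C) := by
  have : D.part C = (⋃ v, ⋃ (_ : v ∈ C), {D.pos v}) ∪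
      ⋃ v, ⋃ w, ⋃ (_ : v ∈ C ∧ G.Adj v w), D.arc v w := by
    ext p
    simp only [part, Set.mem_ofPred_eq, Set.mem_union, Set.mem_iUnion, exists_prop, and_assoc,
      Set.mem_singleton_iff, exists_and_left]
  rw [this]
  refine IsCompact.union ?_ ?_
  · exact isCompact_iUnion fun v => isCompact_iUnion fun _ => isCompact_singleton
  · exact isCompact_iUnion fun v => isCompact_iUnion fun w =>
      isCompact_iUnion fun h => (D.isArc h.2).isCompact

/-- Two parts of a graph without edges between them can be joined by an additional edge. -/
theorem exists_join_of_no_edges [Finite V] (D : Drawing G) {C : Set V} (hC : C.Nonempty)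
    (hC' : Cᶜ.Nonempty) (hno : ∀ v ∈ C, ∀ w, G.Adj v w → w ∈ C) :
    ∃ a ∈ C, ∃ y ∈ Cᶜ, Nonempty (Drawing (G ⊔ SimpleGraph.edge a y)) := by
  have hno' : ∀ v ∈ Cᶜ, ∀ w, G.Adj v w → w ∈ Cᶜ := fun v hv w h hw => hv (hno w hw v h.symm)
  have hdis : ∀ x, x ∈ D.part C → x ∉ D.part Cᶜ := by
    rintro x (⟨v, hv, rfl⟩ | ⟨v, hv, w, hvw, hx⟩) (⟨v', hv', h⟩ | ⟨v', hv', w', hvw', hx'⟩)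
    · exact hv' (D.pos_injective h ▸ hv)
    · rcases D.mem_arc hvw' hx' with rfl | rfl
      · exact hv' hv
      · exact hno' v' hv' _ hvw' hv
    · subst h
      rcases D.mem_arc hvw hx with rfl | rfl
      · exact hv' hv
      · exact hv' (hno v hv _ hvw)
    · obtain ⟨z, hz, hz', -⟩ := D.inter hvw hvw' hx hx' (fun he => by
        rcases Sym2.eq_iff.1 he with ⟨rfl, -⟩ | ⟨rfl, -⟩
        · exact hv' hv
        · exact hno' v' hv' _ hvw' hv)
      have h1 : z ∈ C := by
        rcases hz with rfl | rfl
        · exact hv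
        · exact hno v hv _ hvw
      have h2 : z ∈ Cᶜ := by
        rcases hz' with rfl | rfl
        · exact hv'
        · exact hno' v' hv' _ hvw'
      exact h2 h1
  have hne : ∀ {C : Set V}, C.Nonempty → (D.part C).Nonempty := fun ⟨v, hv⟩ =>
    ⟨D.pos v, Or.inl ⟨v, hv, rfl⟩⟩
  obtain ⟨p, hp, q, hq, hseg⟩ := exists_segment_of_isCompact (D.isCompact_part C)
    (D.isCompact_part Cᶜ) (hne hC) (hne hC')
  have hpq : p ≠ q := fun h => hdis p hp (h ▸ hq)
  have hfree : D.IsFree p q (segment ℝ p q) := by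
    refine ⟨fun v hv => hseg _ hv ?_, fun u v huv x hx hxS => hseg x hxS ?_⟩
    · by_cases h : v ∈ C
      · exact Or.inl (Or.inl ⟨v, h, rfl⟩)
      · exact Or.inr (Or.inl ⟨v, h, rfl⟩)
    · by_cases h : u ∈ C
      · exact Or.inl (Or.inr ⟨u, h, v, huv, hx⟩)
      · exact Or.inr (Or.inr ⟨u, h, v, huv, hx⟩)
  have hS := IsArc.segment hpq
  -- An edge carrying `q` has both ends outside `C`, so it is never an edge with an end in `C`.
  have hq' : ∃ y ∈ Cᶜ, ∀ a v, a ∈ C → D.IsPointAt y s(a, v) q := by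
    rcases hq with ⟨y, hy, rfl⟩ | ⟨y, hy, w, hyw, hq⟩
    · exact ⟨y, hy, fun a v _ => Or.inl rfl⟩
    · by_cases h1 : q = D.pos y
      · exact ⟨y, hy, fun a v _ => Or.inl h1⟩
      by_cases h2 : q = D.pos w
      · exact ⟨w, hno' y hy w hyw, fun a v _ => Or.inl h2⟩
      refine ⟨y, hy, fun a v ha => Or.inr ⟨w, hyw, fun he => ?_, hq, h1, h2⟩⟩
      rcases Sym2.eq_iff.1 he with ⟨rfl, -⟩ | ⟨-, rfl⟩
      · exact hy ha
      · exact hno' y hy _ hyw ha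
  obtain ⟨y, hy, hqy⟩ := hq'
  have hvert : ∀ a ∈ C, p = D.pos a → ∃ a ∈ C, ∃ y ∈ Cᶜ,
      Nonempty (Drawing (G ⊔ SimpleGraph.edge a y)) := by
    rintro a ha rfl
    exact ⟨a, ha, y, hy, D.nonempty_sup_edge_of_vertex (fun h => hy (h ▸ ha)) (hqy a a ha) hS hfree⟩
  rcases hp with ⟨a, ha, h⟩ | ⟨a, ha, v, hav, hp⟩
  · exact hvert a ha h
  · by_cases h1 : p = D.pos a
    · exact hvert a ha h1
    by_cases h2 : p = D.pos v
    · exact hvert v (hno a ha v hav) h2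
    exact ⟨a, ha, y, hy, D.nonempty_sup_edge_of_isFree (fun h => hy (h ▸ ha)) hav hp h1 h2
      (hqy a v ha) hS hfree⟩

end Drawing

/-! ### Consecutive edges around a vertex. -/

/-- Among points on a circle, one of them being `x w` and every other one belonging to one of two
classes `C` and `O`, there are points of different classes that span a chord that does not separate
the other points. -/
theorem exists_chord {ι : Type*} [Finite ι] {o : Plane} {r : ℝ} (hr : 0 < r) {x : ι → Plane}
    {N C O : Set ι} (hx : ∀ i ∈ N, dist (x i) o = r) (hinj : Set.InjOn x N) {w : ι} (hw : w ∈ N)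
    (hN : ∀ i ∈ N, i = w ∨ i ∈ C ∨ i ∈ O) (hwC : w ∉ C) (hwO : w ∉ O)
    (hC : (N ∩ C).Nonempty) (hO : (N ∩ O).Nonempty) :
    ∃ a ∈ N ∩ C, ∃ y ∈ N ∩ O, ∃ (f : Plane →L[ℝ] ℝ) (d : ℝ), f (x a) + d = 0 ∧ f (x y) + d = 0 ∧
      ∀ i ∈ N, i ≠ a → i ≠ y → 0 < f (x i) + d := by
  have hsq : ∀ i ∈ N, (x i 0 - o 0) ^ 2 + (x i 1 - o 1) ^ 2 = r ^ 2 := by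
    intro i hi
    have h := hx i hi
    rw [EuclideanSpace.dist_eq, Fin.sum_univ_two] at h
    have h2 := Real.sq_sqrt (add_nonneg (sq_nonneg (dist (x i 0) (o 0)))
      (sq_nonneg (dist (x i 1) (o 1))))
    rw [h, Real.dist_eq, Real.dist_eq, sq_abs, sq_abs] at h2
    exact h2.symm
  obtain ⟨E0, hE0⟩ : ∃ e, e = x w 0 - o 0 := ⟨_, rfl⟩
  obtain ⟨E1, hE1⟩ : ∃ e, e = x w 1 - o 1 := ⟨_, rfl⟩
  have hE : E0 ^ 2 + E1 ^ 2 = r ^ 2 := by rw [hE0, hE1]; exact hsq w hw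
  have hr2 : 0 < r ^ 2 := by positivity
  -- `P` and `Q` are orthogonal coordinates that turn the circle into the unit circle and `x w` into
  -- `(1, 0)`.
  obtain ⟨P, hPr⟩ : ∃ P : Plane → ℝ, ∀ z, P z * r ^ 2 = (z 0 - o 0) * E0 + (z 1 - o 1) * E1 :=
    ⟨fun z => ((z 0 - o 0) * E0 + (z 1 - o 1) * E1) / r ^ 2, fun z => div_mul_cancel₀ _ hr2.ne'⟩
  obtain ⟨Q, hQr⟩ : ∃ Q : Plane → ℝ, ∀ z, Q z * r ^ 2 = (z 0 - o 0) * E1 - (z 1 - o 1) * E0 :=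
    ⟨fun z => ((z 0 - o 0) * E1 - (z 1 - o 1) * E0) / r ^ 2, fun z => div_mul_cancel₀ _ hr2.ne'⟩
  have hPQ : ∀ i ∈ N, P (x i) ^ 2 + Q (x i) ^ 2 = 1 := by
    intro i hi
    have h1 : (P (x i) * r ^ 2) ^ 2 + (Q (x i) * r ^ 2) ^ 2 = r ^ 2 * r ^ 2 := by
      rw [hPr, hQr]
      calc _ = ((x i 0 - o 0) ^ 2 + (x i 1 - o 1) ^ 2) * (E0 ^ 2 + E1 ^ 2) := by ring
        _ = _ := by rw [hsq i hi, hE]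
    have h2 : (r ^ 2 * r ^ 2) * (P (x i) ^ 2 + Q (x i) ^ 2) = (r ^ 2 * r ^ 2) * 1 := by
      linarith
    exact mul_left_cancel₀ (by positivity) h2
  have hext : ∀ i ∈ N, ∀ j ∈ N, P (x i) = P (x j) → Q (x i) = Q (x j) → i = j := by
    intro i hi j hj h1 h2
    have e1 := hPr (x i); have e2 := hQr (x i)
    have e3 := hPr (x j); have e4 := hQr (x j)
    rw [h1, e3] at e1
    rw [h2, e4] at e2
    have k0 : (x i 0 - x j 0) * r ^ 2 = 0 := by rw [← hE]; linear_combination (-E0) * e1 - E1 * e2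
    have k1 : (x i 1 - x j 1) * r ^ 2 = 0 := by rw [← hE]; linear_combination (-E1) * e1 + E0 * e2
    have k0' := (mul_eq_zero.1 k0).resolve_right hr2.ne'
    have k1' := (mul_eq_zero.1 k1).resolve_right hr2.ne'
    refine hinj hi hj ?_
    ext n
    fin_cases n
    · exact sub_eq_zero.1 k0'
    · exact sub_eq_zero.1 k1'
  have hPw : P (x w) = 1 := by
    have := hPr (x w)
    rw [← hE0, ← hE1] at this
    have h : (P (x w) - 1) * r ^ 2 = 0 := by rw [sub_mul, this]; linear_combination hE
    linarith [(mul_eq_zero.1 h).resolve_right hr2.ne']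
  have hQw : Q (x w) = 0 := by
    have := hQr (x w)
    rw [← hE0, ← hE1] at this
    have h : Q (x w) * r ^ 2 = 0 := by rw [this]; ring
    exact (mul_eq_zero.1 h).resolve_right hr2.ne'
  have hlt : ∀ i ∈ N, i ≠ w → 0 < 1 - P (x i) := by
    intro i hi hne
    have h1 := hPQ i hi
    have h2 : P (x i) ≤ 1 := by nlinarith [sq_nonneg (Q (x i))]
    rcases h2.lt_or_eq with h | h
    · linarith
    · exfalso
      refine hne (hext i hi w hw (h.trans hPw.symm) ?_)
      rw [hQw]
      rw [h] at h1
      have : Q (x i) ^ 2 = 0 := by linarith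
      exact pow_eq_zero_iff two_ne_zero |>.1 this
  -- Stereographic projection from `x w`: the circle is cut at `w`, and the other points are ordered
  -- by the real coordinate `t`.
  obtain ⟨t, hQt⟩ : ∃ t : ι → ℝ, ∀ i ∈ N, i ≠ w → Q (x i) = t i * (1 - P (x i)) :=
    ⟨fun i => Q (x i) / (1 - P (x i)), fun i hi hne => (div_mul_cancel₀ _ (hlt i hi hne).ne').symm⟩
  have hPt : ∀ i ∈ N, i ≠ w → 1 + P (x i) = t i ^ 2 * (1 - P (x i)) := by
    intro i hi hne
    have h1 := hPQ i hi
    rw [hQt i hi hne] at h1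
    have h2 : (1 - P (x i)) * (1 + P (x i)) = (1 - P (x i)) * (t i ^ 2 * (1 - P (x i))) := by
      linear_combination -h1
    exact mul_left_cancel₀ (hlt i hi hne).ne' h2
  have htinj : ∀ i ∈ N, ∀ j ∈ N, i ≠ w → j ≠ w → t i = t j → i = j := by
    intro i hi j hj hiw hjw hij
    have h1 := hPt i hi hiw
    have h2 := hPt j hj hjw
    rw [hij] at h1
    have h3 : (1 + t j ^ 2) * P (x i) = (1 + t j ^ 2) * P (x j) := by linarith
    have h4 : P (x i) = P (x j) := mul_left_cancel₀ (by positivity) h3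
    refine hext i hi j hj h4 ?_
    rw [hQt i hi hiw, hQt j hj hjw, hij, h4]
  -- A closest pair of different classes: a point between them, being of one of the classes, would
  -- form a closer pair.
  obtain ⟨⟨a, y⟩, ⟨ha, hy⟩, hmin⟩ := ((N ∩ C) ×ˢ (N ∩ O)).toFinite.exists_minimalFor
    (fun p => |t p.1 - t p.2|) _ (hC.prod hO)
  simp only at ha hy
  have hmin' : ∀ a' ∈ N ∩ C, ∀ y' ∈ N ∩ O, |t a - t y| ≤ |t a' - t y'| := by
    intro a' ha' y' hy'
    rcases le_total |t a - t y| |t a' - t y'| with h | h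
    · exact h
    · exact hmin (j := (a', y')) ⟨ha', hy'⟩ h
  have haw : a ≠ w := fun h => hwC (h ▸ ha.2)
  have hyw : y ≠ w := fun h => hwO (h ▸ hy.2)
  -- On the circle, `(1 - P) t = Q` and `(1 - P) t ^ 2 = 1 + P`. So `(1 - P) (t - t a) (t - t y) /
  -- 2` is affine in `P` and `Q`; `c0`, `c1` and `d` are its coefficients in the original
  -- coordinates. It vanishes at the two chosen points and is negative exactly for `t` strictly
  -- between them.
  obtain ⟨c0, hc0⟩ : ∃ c, c * (2 * r ^ 2) = E0 - (t a + t y) * E1 - t a * t y * E0 :=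
    ⟨_, div_mul_cancel₀ _ (by positivity)⟩
  obtain ⟨c1, hc1⟩ : ∃ c, c * (2 * r ^ 2) = E1 + (t a + t y) * E0 - t a * t y * E1 :=
    ⟨_, div_mul_cancel₀ _ (by positivity)⟩
  obtain ⟨f, hf⟩ : ∃ f : Plane →L[ℝ] ℝ, ∀ z, f z = c0 * z 0 + c1 * z 1 :=
    ⟨c0 • (EuclideanSpace.proj 0 : Plane →L[ℝ] ℝ) + c1 • (EuclideanSpace.proj 1 : Plane →L[ℝ] ℝ),
      fun z => by simp⟩
  obtain ⟨d, hd⟩ : ∃ d, d = (1 + t a * t y) / 2 - c0 * o 0 - c1 * o 1 := ⟨_, rfl⟩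
  have hfd : ∀ z, f z + d =
      (1 + P z) / 2 - (t a + t y) * Q z / 2 + t a * t y * (1 - P z) / 2 := by
    intro z
    refine mul_right_cancel₀ hr2.ne' ?_
    rw [hf, hd]
    linear_combination (z 0 - o 0) / 2 * hc0 + (z 1 - o 1) / 2 * hc1 -
      (1 - t a * t y) / 2 * hPr z + (t a + t y) / 2 * hQr z
  have hfd' : ∀ i ∈ N, i ≠ w → f (x i) + d = (1 - P (x i)) / 2 * ((t i - t a) * (t i - t y)) := by
    intro i hi hne
    rw [hfd]
    linear_combination (1 / 2) * hPt i hi hne - (t a + t y) / 2 * hQt i hi hne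
  refine ⟨a, ha, y, hy, f, d, ?_, ?_, ?_⟩
  · rw [hfd' a ha.1 haw]; ring
  · rw [hfd' y hy.1 hyw]; ring
  · intro i hi hia hiy
    by_cases hiw : i = w
    -- At `w`, where `t` is not defined by the projection, the affine form takes the value `1`.
    · rw [hiw, hfd, hPw, hQw]; norm_num
    · rw [hfd' i hi hiw]
      refine mul_pos (by linarith [hlt i hi hiw]) ?_
      have n1 : t i - t a ≠ 0 := fun h => hia (htinj i hi a ha.1 hiw haw (sub_eq_zero.1 h))
      have n2 : t i - t y ≠ 0 := fun h => hiy (htinj i hi y hy.1 hiw hyw (sub_eq_zero.1 h))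
      by_contra hneg
      have hneg' : (t i - t a) * (t i - t y) < 0 :=
        lt_of_le_of_ne (not_lt.1 hneg) (mul_ne_zero n1 n2)
      rcases (hN i hi).resolve_left hiw with h | h
      · have := hmin' i ⟨hi, h⟩ y hy
        have := sq_le_sq.2 this
        nlinarith [mul_self_pos.2 n1]
      · have := hmin' a ha i ⟨hi, h⟩
        have := sq_le_sq.2 this
        nlinarith [mul_self_pos.2 n2]

namespace Drawing

variable {V : Type*} {G : SimpleGraph V}

/-- If the neighbours of `u` other than `w` belong to one of two classes, then there are vertices of
different classes that can be joined by an additional edge. -/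
theorem exists_join_of_common_neighbor [Finite V] (D : Drawing G) {u w : V} (huw : G.Adj u w)
    {C O : Set V} (hV : ∀ v, G.Adj u v → v = w ∨ v ∈ C ∨ v ∈ O) (hwC : w ∉ C) (hwO : w ∉ O)
    (hdis : Disjoint C O) (hC : ∃ v ∈ C, G.Adj u v) (hO : ∃ v ∈ O, G.Adj u v) :
    ∃ a ∈ C, ∃ y ∈ O, Nonempty (Drawing (G ⊔ SimpleGraph.edge a y)) := by
  have huF : D.pos u ∉ D.fixedPart u := by
    rintro (⟨v, hv, h⟩ | ⟨v, w, hv, hw, hvw, h⟩)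
    · exact hv (D.pos_injective h).symm
    · rcases D.mem_arc hvw h with h | h
      · exact hv h.symm
      · exact hw h.symm
  -- In this disc there is nothing but `u` and pieces of edges at `u`; the last exits `x v` of these
  -- edges are distinct points of its boundary circle.
  obtain ⟨r, hr, hsub⟩ := Metric.nhds_basis_closedBall.mem_iff.1
    ((D.isClosed_fixedPart u).isOpen_compl.mem_nhds huF)
  set T := Metric.closedBall (D.pos u) r with hT
  have hint : interior T = Metric.ball (D.pos u) r := interior_closedBall _ hr.ne'
  have huT : D.pos u ∈ interior T := by rw [hint]; exact Metric.mem_ball_self hr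
  have hout : ∀ v, v ≠ u → D.pos (id v) ∉ T := fun v hv h => hsub h (Or.inl ⟨v, hv, rfl⟩)
  have hα : ∀ v, G.Adj u v → G.Adj ((fun _ => u) v) (id v) ∧ D.pos ((fun _ => u) v) ∈ interior T :=
    fun v hv => ⟨hv, huT⟩
  obtain ⟨x, S, hS⟩ := D.exists_exits (G' := G) (φ := id) u Metric.isClosed_closedBall hout _ hα
  have hx : ∀ v ∈ G.neighborSet u, dist (x v) (D.pos u) = r := by
    intro v hv
    obtain ⟨-, -, h1, h2, -⟩ := hS v hv
    rw [hint, Metric.mem_ball, not_lt] at h2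
    exact le_antisymm (Metric.mem_closedBall.1 h1) h2
  have hinj : Set.InjOn x (G.neighborSet u) := by
    intro v hv v' hv' h
    by_contra hne
    have hS1 := hS v hv
    have hS2 := hS v' hv'
    obtain ⟨z, hz, hz', hxz⟩ := D.inter (x := x v) hv hv' (hS1.2.1 hS1.1.left_mem)
      (hS2.2.1 (by rw [h]; exact hS2.1.left_mem)) (by
        intro he
        rcases Sym2.eq_iff.1 he with ⟨-, h⟩ | ⟨h, -⟩
        · exact hne h
        · exact (SimpleGraph.Adj.ne hv') h)
    have hzu : z = u := by
      rcases hz with rfl | rfl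
      · rfl
      · exact hz'.resolve_right hne
    exact hS1.2.2.2.1 (by rw [hxz, hzu]; exact huT)
  obtain ⟨c, hc⟩ := hC
  obtain ⟨c', hc'⟩ := hO
  obtain ⟨a, ha, y, hy, f, d, hfa, hfy, hpos⟩ := exists_chord hr hx hinj (w := w) huw hV hwC hwO
    ⟨c, hc.2, hc.1⟩ ⟨c', hc'.2, hc'.1⟩
  have hau : G.Adj u a := ha.1
  have hyu : G.Adj u y := hy.1
  have hay : a ≠ y := fun h => Set.disjoint_left.1 hdis ha.2 (h ▸ hy.2)
  have hfw : 0 < f (x w) + d :=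
    hpos w huw (fun h => hwC (h ▸ ha.2)) (fun h => hwO (h ▸ hy.2))
  -- The centre of the new star is put on the positive side of the chord. This is possible since `x
  -- w` is on that side and is a limit of interior points. All other exits are on that side too, so
  -- the rays meet the chord only at `x a` and `x y`.
  obtain ⟨m, hfm, hm⟩ : ({z | 0 < f z + d} ∩ interior T).Nonempty := by
    have hcl : x w ∈ closure (interior T) := by
      rw [hint, closure_ball _ hr.ne']
      exact (hS w huw).2.2.1
    exact mem_closure_iff.1 hcl _ (isOpen_lt continuous_const (by fun_prop)) hfw
  have hTarc : ∀ v w, v ≠ u → w ≠ u → G.Adj v w → Disjoint (D.arc v w) T :=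
    fun v w hv hw h => Set.disjoint_left.2 fun q hq hqT => hsub hqT (Or.inr ⟨v, w, hv, hw, h, hq⟩)
  obtain ⟨D', h1, h2, h3, h4⟩ := D.exists_star (G' := G) Function.injective_id u
    (convex_closedBall _ _) hm hout (fun v w hv hw h => ⟨h, hTarc v w hv hw h⟩) _ hα x S hS
  have hxT : ∀ v, G.Adj u v → x v ∈ T := fun v hv => (hS v hv).2.2.1
  have hxarc : ∀ v, x v ∈ D'.arc v u := fun v => by
    rw [D'.arc_symm, h4]; exact Or.inl (right_mem_segment _ _ _)
  have hxne : ∀ v, G.Adj u v → x v ≠ D'.pos v := fun v hv h => by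
    rw [h2 v hv.ne'] at h
    exact hout v hv.ne' (h ▸ hxT v hv)
  have hxne' : ∀ v, G.Adj u v → x v ≠ D'.pos u := fun v hv h => by
    rw [h1] at h
    exact (hS v hv).2.2.2.1 (h ▸ hm)
  have hchordT : segment ℝ (x a) (x y) ⊆ T :=
    (convex_closedBall _ _).segment_subset (hxT a hau) (hxT y hyu)
  have hchord : ∀ z ∈ segment ℝ (x a) (x y), f z + d = 0 := by
    rintro z ⟨s, t, -, -, hst, rfl⟩
    simp only [map_add, map_smul, smul_eq_mul]
    linear_combination s * hfa + t * hfy - d * hst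
  have hray : ∀ v, G.Adj u v → ∀ z ∈ segment ℝ m (x v), f z + d = 0 → z = x v := by
    rintro v hv z ⟨s, t, hs, ht, hst, rfl⟩ hz
    simp only [map_add, map_smul, smul_eq_mul] at hz
    have hxv : 0 ≤ f (x v) + d := by
      by_cases hva : v = a
      · rw [hva, hfa]
      by_cases hvy : v = y
      · rw [hvy, hfy]
      exact (hpos v hv hva hvy).le
    have hs0 : s = 0 := by
      have hfm' : 0 < f m + d := hfm
      by_contra hne
      have h5 : 0 < s * (f m + d) := mul_pos (lt_of_le_of_ne hs (Ne.symm hne)) hfm'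
      have h6 : 0 ≤ t * (f (x v) + d) := mul_nonneg ht hxv
      have h7 : s * (f m + d) + t * (f (x v) + d) = 0 := by
        linear_combination hz + d * hst
      linarith
    have ht1 : t = 1 := by linarith
    rw [hs0, ht1, zero_smul, one_smul, zero_add]
  have hstar : ∀ v, G.Adj u v → ∀ z ∈ D'.arc u v, z ∈ segment ℝ (x a) (x y) →
      z = x a ∨ z = x y := by
    intro v hv z hz hzc
    have hzv : z = x v := by
      rw [h4] at hz
      rcases hz with hz | hz
      · exact hray v hv z hz (hchord z hzc)
      · exact (hS v hv).2.2.2.2 ⟨hz, hchordT hzc⟩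
    by_cases hva : v = a
    · exact Or.inl (hva ▸ hzv)
    by_cases hvy : v = y
    · exact Or.inr (hvy ▸ hzv)
    have := hpos v hv hva hvy
    rw [← hzv, hchord z hzc] at this
    exact absurd this (lt_irrefl _)
  have hfree : D'.IsFree (x a) (x y) (segment ℝ (x a) (x y)) := by
    refine ⟨fun v hv => ?_, fun v v' hvv z hz hzc => ?_⟩
    · exfalso
      by_cases hvu : v = u
      · rw [hvu, h1] at hv
        exact (ne_of_gt hfm) (hchord m hv)
      · rw [h2 v hvu] at hv
        exact hout v hvu (hchordT hv)
    · by_cases hvu : v = u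
      · subst hvu
        exact hstar v' hvv z hz hzc
      by_cases hvu' : v' = u
      · subst hvu'
        rw [D'.arc_symm] at hz
        exact hstar v hvv.symm z hz hzc
      rw [h3 v v' hvu hvu'] at hz
      exact absurd (hchordT hzc) (Set.disjoint_left.1 (hTarc v v' hvu hvu' hvv) hz)
  refine ⟨a, ha.2, y, hy.2, D'.nonempty_sup_edge_of_isFree hay hau.symm (hxarc a) (hxne a hau)
    (hxne' a hau) (Or.inr ⟨u, hyu.symm, fun he => ?_, hxarc y, hxne y hyu, hxne' y hyu⟩)
    (IsArc.segment fun h => hay (hinj hau hyu h)) hfree⟩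
  rcases Sym2.eq_iff.1 he with ⟨h, -⟩ | ⟨h, -⟩
  · exact hay h.symm
  · exact hyu.ne h.symm

end Drawing

/-! ### Attachment of components to 3-cliques. -/

/-- In a maximal planar graph, every vertex of a 3-clique has a neighbour in every non-empty union of
components of the rest. -/
theorem IsMaximalPlanar.exists_adj_of_isNClique {V : Type*} [Finite V] {G : SimpleGraph V}
    (hG : IsMaximalPlanar G) {k : Finset V} (hk : G.IsNClique 3 k) {C : Set V} (hC : C.Nonempty)
    (hCk : ∀ v ∈ C, v ∉ k) (hclosed : ∀ v ∈ C, ∀ w, G.Adj v w → w ∈ C ∨ w ∈ k) {z : V}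
    (hz : z ∈ k) : ∃ v ∈ C, G.Adj z v := by
  classical
  by_contra! hcon
  obtain ⟨E⟩ := hG.prop
  obtain ⟨D⟩ := E.nonempty_drawing
  have hmax : ∀ a y, a ≠ y → Nonempty (Drawing (G ⊔ SimpleGraph.edge a y)) → G.Adj a y := by
    rintro a y hay ⟨D'⟩
    refine hG.2 D'.isPlanar le_sup_left (Or.inr ?_)
    rw [SimpleGraph.edge_adj]
    exact ⟨Or.inl ⟨rfl, rfl⟩, hay⟩
  by_cases hu : ∃ u ∈ k, ∃ v ∈ C, G.Adj u v
  · obtain ⟨u, huk, v, hv, huv⟩ := hu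
    have huz : u ≠ z := fun h => hcon v hv (h ▸ huv)
    obtain ⟨w, hwk, hwne⟩ : ∃ w ∈ k, w ∉ ({u, z} : Finset V) :=
      Finset.exists_mem_notMem_of_card_lt_card (by
        rw [hk.card_eq]; exact Finset.card_le_two.trans_lt (by norm_num))
    simp only [Finset.mem_insert, Finset.mem_singleton, not_or] at hwne
    have hkuw : ∀ v ∈ k, v = u ∨ v = w ∨ v = z := by
      have hsub : ({u, w, z} : Finset V) ⊆ k := by
        intro v hv
        simp only [Finset.mem_insert, Finset.mem_singleton] at hv
        rcases hv with rfl | rfl | rfl <;> assumption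
      have hcard : ({u, w, z} : Finset V).card = 3 :=
        Finset.card_eq_three.2 ⟨u, w, z, Ne.symm hwne.1, huz, hwne.2, rfl⟩
      have heq := Finset.eq_of_subset_of_card_le hsub (by rw [hk.card_eq, hcard])
      intro v hv
      rw [← heq] at hv
      simpa using hv
    -- The third vertex `w` is where the order around `u` is cut. It must be in neither class, since
    -- an edge between `C` and `w` would give no contradiction.
    obtain ⟨a, ha, y, ⟨hy1, hy2⟩, hD⟩ := D.exists_join_of_common_neighbor
      (hk.isClique huk hwk (Ne.symm hwne.1)) (C := C) (O := {v | v ∉ C ∧ v ≠ w ∧ v ≠ u})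
      (fun v hv => by
        by_cases h1 : v = w
        · exact Or.inl h1
        by_cases h2 : v ∈ C
        · exact Or.inr (Or.inl h2)
        exact Or.inr (Or.inr ⟨h2, h1, hv.ne'⟩))
      (fun h => hCk w h hwk) (fun h => h.2.1 rfl)
      (Set.disjoint_left.2 fun v hv hv' => hv'.1 hv) ⟨v, hv, huv⟩
      ⟨z, ⟨fun h => hCk z h hz, Ne.symm hwne.2, huz.symm⟩, hk.isClique huk hz huz⟩
    have hadj := hmax a y (fun h => hy1 (h ▸ ha)) hD
    rcases hclosed a ha y hadj with h | h
    · exact hy1 h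
    · rcases hkuw y h with h | h | h
      · exact hy2.2 h
      · exact hy2.1 h
      · exact hcon a ha (h ▸ hadj.symm)
  -- Here `C` is a union of components of `G` itself.
  · push Not at hu
    have hno : ∀ v ∈ C, ∀ w, G.Adj v w → w ∈ C := fun v hv w hvw =>
      (hclosed v hv w hvw).resolve_right fun hw => hu w hw v hv hvw.symm
    obtain ⟨a, ha, y, hy, hD⟩ := D.exists_join_of_no_edges hC ⟨z, fun h => hCk z h hz⟩ hno
    exact hy (hno a ha y (hmax a y (fun h => hy (h ▸ ha)) hD))

/-! ### Closed interiors and their order. -/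

namespace CliqueOrientation

section

variable {V : Type*} {G : SimpleGraph V}

lemma eq_of_subset {k k' : ThreeClique G} (h : k.1 ⊆ k'.1) : k = k' :=
  Subtype.ext (Finset.eq_of_subset_of_card_le h (by rw [k.2.card_eq, k'.2.card_eq]))

lemma exists_mem_notMem {k k' : ThreeClique G} (h : k ≠ k') : ∃ v ∈ k.1, v ∉ k'.1 := by
  by_contra! hcon
  exact h (eq_of_subset hcon)

/-- The subgraph is induced, so only vertices count. In particular a 3-clique outside `F` could
occur, with vertices from several members of `F`. -/
lemma isCliqueOf_graphUnion_iff {t : ThreeClique G} {F : Set (ThreeClique G)} :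
    IsCliqueOf t (graphUnion G F) ↔ ∀ v ∈ t.1, ∃ k ∈ F, v ∈ k.1 := by
  constructor
  · intro h v hv
    obtain ⟨w, hw, hwv⟩ := Finset.exists_mem_ne (by rw [t.2.card_eq]; norm_num) v
    have := h.isClique hv hw hwv.symm
    exact this.1
  · intro h
    exact ⟨fun v hv w hw hne => ⟨h v hv, h w hw, t.2.isClique hv hw hne⟩, t.2.card_eq⟩

end

variable {V : Type*} [Fintype V] [DecidableEq V] {G : SimpleGraph V} (o : CliqueOrientation G)

lemma not_adj {k : ThreeClique G} {i j : V} (hi : i ∈ o.interior k) (hj : j ∈ o.exterior k) :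
    ¬ G.Adj i j := by
  intro h
  obtain ⟨hd, hu, hp⟩ := o.divides k
  obtain ⟨v, hv, hv'⟩ := hp i hi j hj (SimpleGraph.Path.singleton h)
  have hvk : v ∉ o.interior k ∪ o.exterior k := by rw [hu]; simpa using hv
  rw [Finset.mem_union, not_or] at hvk
  have : v = i ∨ v = j := by simpa [SimpleGraph.Path.singleton] using hv'
  rcases this with rfl | rfl
  · exact hvk.1 hi
  · exact hvk.2 hj

lemma notMem_of_mem_interior {k : ThreeClique G} {v : V} (hv : v ∈ o.interior k) : v ∉ k.1 := by
  have : v ∈ o.interior k ∪ o.exterior k := Finset.mem_union_left _ hv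
  rw [(o.divides k).2.1] at this
  simpa using this

lemma notMem_of_mem_exterior {k : ThreeClique G} {v : V} (hv : v ∈ o.exterior k) : v ∉ k.1 := by
  have : v ∈ o.interior k ∪ o.exterior k := Finset.mem_union_right _ hv
  rw [(o.divides k).2.1] at this
  simpa using this

lemma notMem_exterior_of_mem_interior {k : ThreeClique G} {v : V} (hv : v ∈ o.interior k) :
    v ∉ o.exterior k :=
  Finset.disjoint_left.1 (o.divides k).1 hv

lemma mem_interior_or_mem_exterior {k : ThreeClique G} {v : V} (hv : v ∉ k.1) :
    v ∈ o.interior k ∨ v ∈ o.exterior k := by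
  rw [← Finset.mem_union, (o.divides k).2.1]
  simpa using hv

lemma mem_closedInterior_iff {k : ThreeClique G} {v : V} :
    v ∈ o.closedInterior k ↔ v ∈ k.1 ∨ v ∈ o.interior k :=
  Finset.mem_union

lemma mem_closedInterior_iff_notMem_exterior {k : ThreeClique G} {v : V} :
    v ∈ o.closedInterior k ↔ v ∉ o.exterior k := by
  rw [mem_closedInterior_iff]
  constructor
  · rintro (h | h) h'
    · exact o.notMem_of_mem_exterior h' h
    · exact o.notMem_exterior_of_mem_interior h h'
  · intro h
    by_cases hk : v ∈ k.1
    · exact Or.inl hk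
    · exact Or.inr ((o.mem_interior_or_mem_exterior hk).resolve_right h)

lemma card_interior_add_card_exterior (k : ThreeClique G) :
    (o.interior k).card + (o.exterior k).card + 3 = Fintype.card V := by
  have h := Finset.card_compl_add_card k.1
  rw [k.2.card_eq, ← (o.divides k).2.1, Finset.card_union_of_disjoint (o.divides k).1] at h
  exact h

lemma subset_closedInterior_self (k : ThreeClique G) : k.1 ⊆ o.closedInterior k :=
  Finset.subset_union_left

/-- A 3-clique that meets the interior of `k` lies in the closed interior of `k`. -/
lemma subset_closedInterior_of_mem_interior {k k' : ThreeClique G} {v : V} (hv : v ∈ k'.1)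
    (hv' : v ∈ o.interior k) : k'.1 ⊆ o.closedInterior k := by
  intro w hw
  rw [mem_closedInterior_iff_notMem_exterior]
  intro hw'
  have hne : v ≠ w := by
    rintro rfl
    exact o.notMem_exterior_of_mem_interior hv' hw'
  exact o.not_adj hv' hw' (k'.2.isClique hv hw hne)

/-- If `R` is a union of components of the rest of a 3-clique `k`, and is divided into parts `P` and
`Q` without edges between them, then `R` lies in `Q` if `Q` contains a vertex of `k`. -/
lemma subset_part (hG : IsMaximalPlanar G) {k : ThreeClique G} {P Q R : Finset V}
    (hPQ : ∀ i ∈ P, ∀ j ∈ Q, ¬ G.Adj i j) (hR : ∀ v ∈ R, v ∉ k.1)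
    (hRc : ∀ v ∈ R, ∀ w, G.Adj v w → w ∈ R ∨ w ∈ k.1) (hRPQ : ∀ v ∈ R, v ∈ P ∨ v ∈ Q)
    {z : V} (hz : z ∈ k.1) (hzQ : z ∈ Q) : R ⊆ Q := by
  intro v hv
  by_contra hvQ
  -- The part of `R` in `P` is itself a union of components of the rest of `k`. If it is non-empty,
  -- `z` has a neighbour in it, contrary to `z ∈ Q`.
  obtain ⟨c, hc, hzc⟩ := hG.exists_adj_of_isNClique k.2 (C := {v | v ∈ R ∧ v ∈ P})
    ⟨v, hv, (hRPQ v hv).resolve_right hvQ⟩ (fun v hv => hR v hv.1)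
    (fun v hv w hvw => (hRc v hv.1 w hvw).imp_left fun hw =>
      ⟨hw, (hRPQ w hw).resolve_right fun hw' => hPQ v hv.2 w hw' hvw⟩) hz
  exact hPQ c hc.2 z hzQ hzc.symm

/-- Since `k'` misses the exterior of `k`, this exterior is divided by `k'`. By `subset_part` it
lies entirely on the side of `k'` that contains a vertex `z` of `k` not in `k'`. Only the exterior
side is possible, and passing to complements gives the inclusion. -/
lemma closedInterior_ssubset (hG : IsMaximalPlanar G) {k k' : ThreeClique G}
    (h : k'.1 ⊆ o.closedInterior k) (hne : k' ≠ k) : o.closedInterior k' ⊂ o.closedInterior k := by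
  obtain ⟨z, hz, hz'⟩ := exists_mem_notMem hne.symm
  have hR : ∀ v ∈ o.exterior k, v ∉ k.1 := fun v => o.notMem_of_mem_exterior
  have hRc : ∀ v ∈ o.exterior k, ∀ w, G.Adj v w → w ∈ o.exterior k ∨ w ∈ k.1 := by
    intro v hv w hvw
    by_cases hw : w ∈ k.1
    · exact Or.inr hw
    · exact Or.inl ((o.mem_interior_or_mem_exterior hw).resolve_left fun hw' =>
        o.not_adj hw' hv hvw.symm)
  have hRk : ∀ v ∈ o.exterior k, v ∈ o.interior k' ∨ v ∈ o.exterior k' := fun v hv =>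
    o.mem_interior_or_mem_exterior fun hv' =>
      o.mem_closedInterior_iff_notMem_exterior.1 (h hv') hv
  rcases o.mem_interior_or_mem_exterior hz' with hzi | hze
  · exfalso
    have hsub : o.exterior k ⊆ o.interior k' := subset_part hG
      (fun i hi j hj hij => o.not_adj hj hi hij.symm) hR hRc (fun v hv => (hRk v hv).symm) hz hzi
    -- This nesting would give `|ext k| < |int k'| ≤ |ext k'|`. But `|int k| ≤ |ext k|`, and
    -- interior and exterior have the same total size for both 3-cliques.
    have hssub : o.exterior k ⊂ o.interior k' :=
      Finset.ssubset_iff_subset_ne.2 ⟨hsub, fun h => hR z (h ▸ hzi) hz⟩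
    have h1 := Finset.card_lt_card hssub
    have h2 := o.card_le k
    have h3 := o.card_le k'
    have h4 := o.card_interior_add_card_exterior k
    have h5 := o.card_interior_add_card_exterior k'
    omega
  · have hsub : o.exterior k ⊆ o.exterior k' := subset_part hG
      (fun i hi j hj => o.not_adj hi hj) hR hRc hRk hz hze
    refine Finset.ssubset_iff_subset_ne.2 ⟨fun v hv => ?_, fun heq => ?_⟩
    · rw [mem_closedInterior_iff_notMem_exterior] at hv ⊢
      exact fun hv' => hv (hsub hv')
    · have := o.subset_closedInterior_self k hz
      rw [← heq, mem_closedInterior_iff_notMem_exterior] at this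
      exact this hze

lemma cliqueLE_iff (hG : IsMaximalPlanar G) {k k' : ThreeClique G} :
    o.cliqueLE k' k ↔ k'.1 ⊆ o.closedInterior k := by
  refine ⟨(o.subset_closedInterior_self k').trans, fun h => ?_⟩
  by_cases hne : k' = k
  · rw [hne]; exact subset_rfl
  · exact (o.closedInterior_ssubset hG h hne).1

lemma cliqueLE_antisymm (hG : IsMaximalPlanar G) {k k' : ThreeClique G} (h : o.cliqueLE k k')
    (h' : o.cliqueLE k' k) : k = k' := by
  by_contra hne
  exact (o.closedInterior_ssubset hG ((o.cliqueLE_iff hG).1 h) hne).2 h'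

/-- The closed interiors of incomparable 3-cliques have only common vertices of these 3-cliques in
common. -/
lemma mem_and_mem_of_incomparable (hG : IsMaximalPlanar G) {k k' : ThreeClique G}
    (h : ¬ o.cliqueLE k k') (h' : ¬ o.cliqueLE k' k) {v : V} (hv : v ∈ o.closedInterior k)
    (hv' : v ∈ o.closedInterior k') : v ∈ k.1 ∧ v ∈ k'.1 := by
  have h1 : ∀ w ∈ k'.1, w ∉ o.interior k := fun w hw hw' =>
    h' ((o.cliqueLE_iff hG).2 (o.subset_closedInterior_of_mem_interior hw hw'))
  have h2 : ∀ w ∈ k.1, w ∉ o.interior k' := fun w hw hw' =>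
    h ((o.cliqueLE_iff hG).2 (o.subset_closedInterior_of_mem_interior hw hw'))
  rw [cliqueLE_iff o hG, Finset.not_subset] at h
  obtain ⟨z, hz, hzk⟩ := h
  have hze : z ∈ o.exterior k' := by
    by_contra hn
    exact hzk (o.mem_closedInterior_iff_notMem_exterior.2 hn)
  -- The interior of `k` avoids `k'`, so it is pulled to the side of `k'` that contains the vertex
  -- `z` of `k`, which is the exterior.
  have hsub : o.interior k ⊆ o.exterior k' := by
    refine subset_part hG (fun i hi j hj => o.not_adj hi hj)
      (fun v => o.notMem_of_mem_interior) (fun v hv w hvw => ?_)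
      (fun v hv => o.mem_interior_or_mem_exterior fun hv' => h1 v hv' hv) hz hze
    by_cases hw : w ∈ k.1
    · exact Or.inr hw
    · exact Or.inl ((o.mem_interior_or_mem_exterior hw).resolve_right fun hw' =>
        o.not_adj hv hw' hvw)
  have hvk : v ∈ k.1 := (o.mem_closedInterior_iff.1 hv).resolve_right fun hvi =>
    o.mem_closedInterior_iff_notMem_exterior.1 hv' (hsub hvi)
  exact ⟨hvk, (o.mem_closedInterior_iff.1 hv').resolve_right (h2 v hvk)⟩

/-! ### Covering in `K'` and the 3-cliques of a bubble. -/

/-- `x` covers the 3-clique `t` in `K'`. -/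
def IsChild (t : ThreeClique G) (x : Option (ThreeClique G)) : Prop :=
  o.cliqueLE' (some t) x ∧ some t ≠ x ∧
    ∀ c, o.cliqueLE t c → o.cliqueLE' (some c) x → c = t ∨ some c = x

lemma isChild_some_iff {t k : ThreeClique G} : o.IsChild t (some k) ↔ o.cliqueGraph.Adj t k := by
  simp only [IsChild, cliqueGraph, Covers, Option.some.injEq, ne_eq]
  exact Iff.rfl

lemma isChild_none_iff {t : ThreeClique G} : o.IsChild t none ↔ o.IsMaximalClique t := by
  constructor
  · intro h c hc
    exact (h.2.2 c hc (Finset.subset_univ _)).resolve_right (by simp)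
  · exact fun h => ⟨Finset.subset_univ _, by simp, fun c hc _ => Or.inl (h c hc)⟩

lemma bubble_eq (x : Option (ThreeClique G)) :
    o.bubble x = graphUnion G {k | some k = x ∨ o.IsChild k x} := by
  cases x with
  | none => simp [bubble, isChild_none_iff]
  | some k => simp [bubble, isChild_some_iff]

lemma IsRoot.exists_isChild {x : Option (ThreeClique G)} (hx : o.IsRoot x) (hne : x ≠ none) :
    ∃ c, o.IsChild c x := by
  cases x with
  | none => exact absurd rfl hne
  | some k =>
    obtain ⟨c, hc⟩ := hx
    exact ⟨c, o.isChild_some_iff.2 hc⟩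

lemma IsChild.isRoot {t : ThreeClique G} {x : Option (ThreeClique G)} (h : o.IsChild t x) :
    o.IsRoot x := by
  cases x with
  | none => trivial
  | some k => exact ⟨t, o.isChild_some_iff.1 h⟩

/-- The cover is a 3-clique with smallest closed interior strictly above `t` and below `x`, or `x`
itself if there is none. -/
lemma exists_parent (hG : IsMaximalPlanar G) {t : ThreeClique G} {x : Option (ThreeClique G)}
    (h : o.cliqueLE' (some t) x) (hne : some t ≠ x) :
    ∃ p, o.IsChild t p ∧ o.cliqueLE' p x := by
  classical
  by_cases hS : ∃ c, c ≠ t ∧ o.cliqueLE t c ∧ o.cliqueLE' (some c) x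
  · obtain ⟨c, ⟨hct, htc, hcx⟩, hmin⟩ := Set.exists_min_image
      {c | c ≠ t ∧ o.cliqueLE t c ∧ o.cliqueLE' (some c) x} (fun c => (o.closedInterior c).card)
      (Set.toFinite _) hS
    refine ⟨some c, ⟨htc, fun h => hct (Option.some_injective _ h).symm, fun d htd hdc => ?_⟩, hcx⟩
    by_cases hdt : d = t
    · exact Or.inl hdt
    right
    have hle := hmin d ⟨hdt, htd, Finset.Subset.trans hdc hcx⟩
    have : o.closedInterior d = o.closedInterior c := Finset.eq_of_subset_of_card_le hdc hle
    exact congrArg some (o.cliqueLE_antisymm hG this.subset this.superset)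
  · push Not at hS
    refine ⟨x, ⟨h, hne, fun c htc hcx => ?_⟩, Finset.Subset.refl _⟩
    by_contra! hcon
    exact hS c hcon.1 htc hcx

/-- Dually, the closed interior is maximized among the 3-cliques above `t` and below `x`, other than
`x`. -/
lemma exists_child_above (hG : IsMaximalPlanar G) {t : ThreeClique G} {x : Option (ThreeClique G)}
    (h : o.cliqueLE' (some t) x) (hne : some t ≠ x) :
    ∃ c, o.IsChild c x ∧ o.cliqueLE t c := by
  classical
  obtain ⟨c, ⟨hcx, htc, hle⟩, hmax⟩ := Set.exists_max_image
    {c | some c ≠ x ∧ o.cliqueLE t c ∧ o.cliqueLE' (some c) x} (fun c => (o.closedInterior c).card)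
    (Set.toFinite _) ⟨t, hne, Finset.Subset.refl _, h⟩
  refine ⟨c, ⟨hle, hcx, fun d hcd hdx => ?_⟩, htc⟩
  by_cases hd : some d = x
  · exact Or.inr hd
  left
  have hle' := hmax d ⟨hd, Finset.Subset.trans htc hcd, hdx⟩
  have : o.closedInterior c = o.closedInterior d := Finset.eq_of_subset_of_card_le hcd hle'
  exact o.cliqueLE_antisymm hG this.superset this.subset

/-- The 3-cliques of a bubble are its root and the 3-cliques covered by the root. -/
theorem isCliqueOf_bubble_iff (hG : IsMaximalPlanar G) {t : ThreeClique G}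
    {x : Option (ThreeClique G)} : IsCliqueOf t (o.bubble x) ↔ some t = x ∨ o.IsChild t x := by
  rw [bubble_eq, isCliqueOf_graphUnion_iff]
  refine ⟨fun h => ?_, fun h v hv => ⟨t, h, hv⟩⟩
  by_cases htx : some t = x
  · exact Or.inl htx
  right
  have hsub : o.cliqueLE' (some t) x := by
    have h1 : t.1 ⊆ o.closedInterior' x := by
      intro v hv
      obtain ⟨k, hk | hk, hvk⟩ := h v hv
      · rw [← hk]; exact o.subset_closedInterior_self k hvk
      · exact hk.1 (o.subset_closedInterior_self k hvk)
    cases x with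
    | none => exact Finset.subset_univ _
    | some k => exact (o.cliqueLE_iff hG).2 h1
  -- If `t` is not the child `c` above it, it has a vertex in the interior of `c`. The member of the
  -- bubble supplying this vertex then lies strictly below `c`, but neither the root nor another
  -- child does.
  obtain ⟨c, hc, htc⟩ := o.exists_child_above hG hsub htx
  by_cases heq : t = c
  · exact heq ▸ hc
  exfalso
  obtain ⟨v, hv, hvc⟩ := exists_mem_notMem heq
  have hvi : v ∈ o.interior c := (o.mem_closedInterior_iff.1
    (htc (o.subset_closedInterior_self t hv))).resolve_left hvc
  obtain ⟨k, hk, hvk⟩ := h v hv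
  have hkc : o.cliqueLE k c :=
    (o.cliqueLE_iff hG).2 (o.subset_closedInterior_of_mem_interior hvk hvi)
  have hkne : k ≠ c := fun h => hvc (h ▸ hvk)
  rcases hk with rfl | hk
  · exact hkne (o.cliqueLE_antisymm hG hkc hc.1)
  · rcases hk.2.2 c hkc hc.1 with h | h
    · exact hkne h.symm
    · exact hc.2.1 h

/-- Two different covers cannot be comparable. If they are incomparable, `t` lies in both closed
interiors, hence consists of vertices of the cover `k` and equals it. -/
lemma IsChild.unique (hG : IsMaximalPlanar G) {t : ThreeClique G} {x y : Option (ThreeClique G)}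
    (hx : o.IsChild t x) (hy : o.IsChild t y) : x = y := by
  have key : ∀ {k : ThreeClique G} {y}, o.IsChild t (some k) → o.IsChild t y →
      o.cliqueLE' (some k) y → some k = y := fun {k y} hk hy h =>
    (hy.2.2 k hk.1 h).resolve_left fun h => hk.2.1 (congrArg some h.symm)
  cases x with
  | none =>
    cases y with
    | none => rfl
    | some k => exact (key hy hx (Finset.subset_univ _)).symm
  | some k =>
    cases y with
    | none => exact key hx hy (Finset.subset_univ _)
    | some k' =>
      by_cases h : o.cliqueLE k k'
      · exact key hx hy h
      by_cases h' : o.cliqueLE k' k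
      · exact (key hy hx h').symm
      exfalso
      refine hx.2.1 (congrArg some (eq_of_subset fun v hv => ?_))
      have hv' := o.subset_closedInterior_self t hv
      exact (o.mem_and_mem_of_incomparable hG h h' (hx.1 hv') (hy.1 hv')).1

/-! ### Roots and the bubble tree. -/

/-- On all of `K'` antisymmetry can fail: if `G` is a triangle, its 3-clique and `none` have the
same closed interior. A root other than `none` has something below it, hence a non-empty interior,
hence a non-empty exterior. -/
lemma eq_of_root_le (hG : IsMaximalPlanar G) {x y : Option (ThreeClique G)} (hx : o.IsRoot x)
    (hy : o.IsRoot y) (h : o.cliqueLE' x y) (h' : o.cliqueLE' y x) : x = y := by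
  have key : ∀ k : ThreeClique G, o.IsRoot (some k) → ¬ o.cliqueLE' none (some k) := by
    intro k hk hle
    obtain ⟨c, hc⟩ := IsRoot.exists_isChild o hk (by simp)
    obtain ⟨v, hv, hvk⟩ := exists_mem_notMem fun h : c = k => hc.2.1 (congrArg some h)
    have hvi : v ∈ o.interior k := (o.mem_closedInterior_iff.1
      (hc.1 (o.subset_closedInterior_self c hv))).resolve_left hvk
    have hpos : 0 < (o.exterior k).card := (Finset.card_pos.2 ⟨v, hvi⟩).trans_le (o.card_le k)
    obtain ⟨w, hw⟩ := Finset.card_pos.1 hpos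
    exact o.mem_closedInterior_iff_notMem_exterior.1 (hle (Finset.mem_univ w)) hw
  cases x with
  | none =>
    cases y with
    | none => rfl
    | some k => exact absurd h (key k hy)
  | some k =>
    cases y with
    | none => exact absurd h' (key k hx)
    | some k' => exact congrArg some (o.cliqueLE_antisymm hG h h')

lemma IsChild.not_symm (hG : IsMaximalPlanar G) {c c' : ThreeClique G}
    (h : o.IsChild c (some c')) : ¬ o.IsChild c' (some c) := fun h' =>
  h.2.1 (congrArg some (o.cliqueLE_antisymm hG h.1 h'.1))

/-- If different roots had the same bubble, a child of one would have to be the other root, by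
uniqueness of covers. By symmetry the roots would cover each other. -/
lemma bubble_injOn (hG : IsMaximalPlanar G) : Set.InjOn o.bubble {x | o.IsRoot x} := by
  intro x (hx : o.IsRoot x) y (hy : o.IsRoot y) heq
  by_contra hne
  have key : ∀ {x y}, o.IsRoot x → o.bubble x = o.bubble y → x ≠ y → x ≠ none →
      ∃ c, some c = y ∧ o.IsChild c x := by
    intro x y hx heq hne hxn
    obtain ⟨c, hc⟩ := IsRoot.exists_isChild o hx hxn
    have : IsCliqueOf c (o.bubble y) := heq ▸ (o.isCliqueOf_bubble_iff hG).2 (Or.inr hc)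
    rcases (o.isCliqueOf_bubble_iff hG).1 this with h | h
    · exact ⟨c, h, hc⟩
    · exact absurd (hc.unique o hG h) hne
  by_cases hxn : x = none
  · obtain ⟨c, hc, -⟩ := key hy heq.symm (Ne.symm hne) fun h => hne (hxn.trans h.symm)
    exact absurd (hc.trans hxn) (by simp)
  · obtain ⟨c, rfl, hc⟩ := key hx heq hne hxn
    obtain ⟨c', rfl, hc'⟩ := key hy heq.symm (Ne.symm hne) (by simp)
    exact hc.not_symm o hG hc'

lemma bubbleLE_iff (hG : IsMaximalPlanar G) {b b' : o.bubbles} {x y : Option (ThreeClique G)}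
    (hx : o.IsRoot x) (hxb : o.bubble x = b.1) (hy : o.IsRoot y) (hyb : o.bubble y = b'.1) :
    o.bubbleLE b b' ↔ o.cliqueLE' x y := by
  constructor
  · rintro ⟨x', y', hx', hxb', hy', hyb', h⟩
    rwa [o.bubble_injOn hG hx hx' (hxb.trans hxb'.symm),
      o.bubble_injOn hG hy hy' (hyb.trans hyb'.symm)]
  · exact fun h => ⟨x, y, hx, hxb, hy, hyb, h⟩

/-- In the bubble tree, a bubble covers another one if its root covers the other root. -/
theorem bubbleTree_adj_iff (hG : IsMaximalPlanar G) {b b' : o.bubbles}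
    {x y : Option (ThreeClique G)} (hx : o.IsRoot x) (hxb : o.bubble x = b.1) (hy : o.IsRoot y)
    (hyb : o.bubble y = b'.1) : o.bubbleTree.Adj b b' ↔ ∃ t, some t = y ∧ o.IsChild t x := by
  have hbub : ∀ {x y}, o.IsRoot x → o.IsRoot y → ∀ {b b' : o.bubbles}, o.bubble x = b.1 →
      o.bubble y = b'.1 → (b = b' ↔ x = y) := by
    intro x y hx hy b b' hxb hyb
    rw [Subtype.ext_iff, ← hxb, ← hyb]
    exact ⟨fun h => o.bubble_injOn hG hx hy h, fun h => by rw [h]⟩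
  constructor
  · rintro ⟨hle, hne, hcov⟩
    rw [bubbleLE_iff o hG hy hyb hx hxb] at hle
    have hyx : y ≠ x := fun h => hne ((hbub hy hx hyb hxb).2 h)
    cases y with
    | none =>
      refine absurd (o.eq_of_root_le hG hy hx hle ?_) hyx
      exact Finset.subset_univ _
    | some t =>
      -- A cover `p` of `t` below `x` is itself a root, so its bubble lies between the given ones
      -- and must be one of them.
      obtain ⟨p, hp, hpx⟩ := o.exists_parent hG hle hyx
      have hpr := hp.isRoot o
      have := hcov ⟨o.bubble p, p, hpr, rfl⟩ ((o.bubbleLE_iff hG hy hyb hpr rfl).2 hp.1)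
        ((o.bubbleLE_iff hG hpr rfl hx hxb).2 hpx)
      rw [hbub hpr hy rfl hyb, hbub hpr hx rfl hxb] at this
      rcases this with h | h
      · exact absurd h.symm hp.2.1
      · exact ⟨t, rfl, h ▸ hp⟩
  -- Roots form a subset of `K'`, so nothing new can come between.
  · rintro ⟨t, rfl, ht⟩
    refine ⟨(o.bubbleLE_iff hG hy hyb hx hxb).2 ht.1,
      fun h => ht.2.1 ((hbub hy hx hyb hxb).1 h), fun z hyz hzx => ?_⟩
    obtain ⟨p, hp, hpz⟩ := z.2
    rw [bubbleLE_iff o hG hy hyb hp hpz] at hyz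
    rw [bubbleLE_iff o hG hp hpz hx hxb] at hzx
    rw [hbub hp hy hpz hyb, hbub hp hx hpz hxb]
    cases p with
    | none => exact Or.inr (o.eq_of_root_le hG hp hx hzx (Finset.subset_univ _))
    | some c => exact (ht.2.2 c hyz hzx).imp_left (congrArg some)

end CliqueOrientation

theorem mainTheorem5 {V : Type*} [Fintype V] [DecidableEq V] (G : SimpleGraph V)
    (hG : IsMaximalPlanar G) (hK : ∀ v : V, ∃ k : ThreeClique G, v ∈ k.1)
    (o : CliqueOrientation G) (b b' : o.bubbles) (hne : b ≠ b') :
    (o.BubbleNeighbors b b' ↔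
      ∃ k : ThreeClique G, CliqueOrientation.IsCliqueOf k b.1 ∧
        CliqueOrientation.IsCliqueOf k b'.1) ∧
    (o.BubbleNeighbors b b' →
      ∃! k : ThreeClique G, CliqueOrientation.IsCliqueOf k b.1 ∧
        CliqueOrientation.IsCliqueOf k b'.1) := by
  obtain ⟨x, hx, hxb⟩ := b.2
  obtain ⟨y, hy, hyb⟩ := b'.2
  have hxy : x ≠ y := fun h => hne (Subtype.ext (by rw [← hxb, ← hyb, h]))
  have hnb : o.BubbleNeighbors b b' ↔
      ∃ t, (some t = y ∧ o.IsChild t x) ∨ (some t = x ∧ o.IsChild t y) := by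
    rw [CliqueOrientation.BubbleNeighbors, o.bubbleTree_adj_iff hG hx hxb hy hyb,
      o.bubbleTree_adj_iff hG hy hyb hx hxb, exists_or]
  have hcl : ∀ t : ThreeClique G, (CliqueOrientation.IsCliqueOf t b.1 ∧
      CliqueOrientation.IsCliqueOf t b'.1) ↔
      (some t = y ∧ o.IsChild t x) ∨ (some t = x ∧ o.IsChild t y) := by
    intro t
    rw [← hxb, ← hyb, o.isCliqueOf_bubble_iff hG, o.isCliqueOf_bubble_iff hG]
    constructor
    · rintro ⟨h1 | h1, h2 | h2⟩
      · exact absurd (h1.symm.trans h2) hxy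
      · exact Or.inr ⟨h1, h2⟩
      · exact Or.inl ⟨h2, h1⟩
      · exact absurd (h1.unique o hG h2) hxy
    · rintro (⟨h1, h2⟩ | ⟨h1, h2⟩)
      · exact ⟨Or.inr h2, Or.inl h1⟩
      · exact ⟨Or.inl h1, Or.inr h2⟩
  simp only [hcl]
  refine ⟨hnb, fun h => ?_⟩
  obtain ⟨t, ht⟩ := hnb.1 h
  refine ⟨t, ht, fun t' ht' => ?_⟩
  -- In the mixed cases each of the two roots would cover the other.
  rcases ht with ⟨h1, h2⟩ | ⟨h1, h2⟩ <;> rcases ht' with ⟨h1', h2'⟩ | ⟨h1', h2'⟩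
  · exact Option.some_injective _ (h1'.trans h1.symm)
  · subst h1
    subst h1'
    exact absurd h2' (h2.not_symm o hG)
  · subst h1
    subst h1'
    exact absurd h2' (h2.not_symm o hG)
  · exact Option.some_injective _ (h1'.trans h1.symm)
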